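/- All graphs are finite, without loops or multiple edges. Let $P_k$ denote the path on $k$ vertices and $C_n$ the cycle on $n$ vertices. A graph is $P_k$-free if it has no induced subgraph isomorphic to $P_k$, and it is $C_n$-colorable if there is a map from its vertex set to the vertex set of $C_n$ that sends adjacent vertices to adjacent vertices. Let $k>4$ be an integer, and let $G$ be a graph that is $P_k$-free and not $C_{k-2}$-colorable, such that no proper induced subgraph of $G$ is both $P_k$-free and not $C_{k-2}$-colorable. Then $G$ has at most $3k+28$ vertices. -/

import Mathlib

universe u v w

/-- `G` is `H`-free: `H` is not an induced subgraph of `G`. -/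
def IndFree {V : Type v} {W : Type w} (H : SimpleGraph W) (G : SimpleGraph V) : Prop :=
  ¬ H.IsIndContained G

/-- `G` is `H`-colorable: some map from the vertices of `G` to the vertices of `H` sends adjacent
vertices to adjacent vertices. -/
def HColorable {V : Type v} {W : Type w} (H : SimpleGraph W) (G : SimpleGraph V) : Prop :=
  Nonempty (G →g H)

/-- `G` has the property `P`, and no proper induced subgraph of `G` has the property `P`. -/
def IsIndMinimal (P : (W : Type u) → SimpleGraph W → Prop) {V : Type u} (G : SimpleGraph V) :
    Prop :=
  P V G ∧ ∀ s : Set V, s ≠ Set.univ → ¬ P s (G.induce s)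

/-!
Let `m = k - 2`. Colourings of `G` by the cycle of length `m` are treated as labellings of the
vertices by residues modulo `m` such that the labels of adjacent vertices differ by `1`. By
minimality, every set of vertices that cannot be labelled consists of all vertices. So it suffices
to find a small set without a labelling, assuming that `G` has more than `3 * k + 28` vertices.

**Reduction to odd girth `m`.** `G` is not bipartite, and a shortest odd closed walk of `G` is an
induced cycle, of length at most `k` since `G` is `P_k`-free. If this cycle cannot be labelled, it
is all of `G`. Otherwise `m` is odd and the length of the cycle is `m` or `k`
(`closed_walk_labels`). If it is `k`, every vertex is adjacent to both neighbours of some vertex of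
the cycle, so that `G` maps to the cycle of length `k` and thus has a labelling
(`Critical.not_shortest_odd_cycle_eq`).

**The case `m ≥ 5`.** Let `c` be the cycle of length `m`. A labelling of a set that contains `c`
may be taken to be the identity on `c`. Since there are no induced paths on `m + 2` vertices, all
vertices are at distance at most two from `c`, and every vertex `v` has a *centre* `a` such that
its label can only be `a - 1` or `a + 1` (`LargeObstruction.exists_center`). The conditions on
these labels amount to a satisfiability problem with two literals per clause: labels forced by at
most six vertices, and implications from the lower label of `v` to the lower label of `w`, when `v`
and `w` are adjacent and the centre of `w` is one more than that of `v`
(`LargeObstruction.center_sub`). As there is no labelling, some chain of implications leads from a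
vertex with forced lower label to a vertex with forced upper label. In a shortest such chain,
chords only join vertices at distance `-1` modulo `m`. A chain of more than `m + 5` edges would
contain a chord, and the ends of this chord, two more vertices of the chain, one auxiliary vertex
and a part of `c` would give an induced path on `m + 2` vertices
(`LargeObstruction.chain_length_lt`). A chain of at most `m + 5` edges, together with one auxiliary
vertex for each of its inner vertices, the forcing sets and `c`, has at most `3 * k + 16` vertices
and cannot be labelled (`LargeObstruction.not_exists`).

**The case `m = 3`.** Now `k = 5` and `G` is an obstruction to three-colourability that contains a
triangle. If `G` is not `K₄`, it contains two triangles sharing an edge, or a triangle with a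
pendant vertex. Starting from these graphs, a verified search adds one vertex at a time. As long as
the graph is three-colourable, minimality requires a further vertex in one of finitely many
adjacency types (`Search.hits_required`), and types that create a `K₄` or an induced path on five
vertices are discarded. The search ends with graphs that are not three-colourable, on at most `14`
vertices (`card_le_of_triangle`).
-/

namespace CycleObstruction

variable {V : Type u}

/-! ### Maps to a cycle as labellings by residues -/

/-- On the vertices of `S`, the labelling `f` by residues modulo `m` is a homomorphism to the cycle
of length `m`: the labels of adjacent vertices differ by one. -/
def ColOn {m : ℕ} (G : SimpleGraph V) (S : Set V) (f : V → ZMod m) : Prop :=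
  ∀ ⦃x⦄, x ∈ S → ∀ ⦃y⦄, y ∈ S → G.Adj x y → f y = f x + 1 ∨ f x = f y + 1

lemma ColOn.mono {m : ℕ} {G : SimpleGraph V} {S T : Set V} {f : V → ZMod m} (h : ColOn G T f)
    (hST : S ⊆ T) : ColOn G S f :=
  fun _ hx _ hy hxy => h (hST hx) (hST hy) hxy

lemma cycleGraph_adj_zmod {n : ℕ} (a b : ZMod (n + 2)) :
    (SimpleGraph.cycleGraph (n + 2)).Adj (show Fin (n + 2) from a) (show Fin (n + 2) from b) ↔
      b = a + 1 ∨ a = b + 1 := by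
  change (a - b = 1 ∨ b - a = 1) ↔ _
  rw [sub_eq_iff_eq_add', sub_eq_iff_eq_add', or_comm]

lemma hColorable_induce_iff {m : ℕ} (hm : 2 ≤ m) (G : SimpleGraph V) (S : Set V) :
    HColorable (SimpleGraph.cycleGraph m) (G.induce S) ↔ ∃ f : V → ZMod m, ColOn G S f := by
  classical
  obtain ⟨n, rfl⟩ : ∃ n, m = n + 2 := ⟨m - 2, by omega⟩
  constructor
  · rintro ⟨φ⟩
    let F : V → Fin (n + 2) := fun v => if h : v ∈ S then φ ⟨v, h⟩ else 0
    have hF : ∀ v (h : v ∈ S), F v = φ ⟨v, h⟩ := fun v h => dif_pos h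
    refine ⟨F, ?_⟩
    intro x hx y hy hxy
    have h : (SimpleGraph.cycleGraph (n + 2)).Adj (φ ⟨x, hx⟩) (φ ⟨y, hy⟩) :=
      φ.map_rel (by simpa using hxy)
    rw [← hF x hx, ← hF y hy] at h
    exact (cycleGraph_adj_zmod (F x) (F y)).mp h
  · rintro ⟨f, hf⟩
    exact ⟨⟨fun x => f x.1, fun {x y} hxy =>
      (cycleGraph_adj_zmod (f x.1) (f y.1)).mpr (hf x.2 y.2 hxy)⟩⟩

lemma hColorable_iff {m : ℕ} (hm : 2 ≤ m) (G : SimpleGraph V) :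
    HColorable (SimpleGraph.cycleGraph m) G ↔ ∃ f : V → ZMod m, ColOn G Set.univ f := by
  rw [← hColorable_induce_iff hm]
  constructor
  · rintro ⟨φ⟩
    exact ⟨φ.comp (SimpleGraph.induceUnivIso G).toHom⟩
  · rintro ⟨φ⟩
    exact ⟨φ.comp (SimpleGraph.induceUnivIso G).symm.toHom⟩

/-- Going once around a closed walk of odd length `l`, a labelling whose consecutive labels differ
by one has total increment an odd multiple of `m`. So `m` is odd and at most `l`, and if `l = m`
all increments have the same sign. -/
lemma closed_walk_labels {m l : ℕ} (h : ℕ → ZMod m) (hl : Odd l)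
    (step : ∀ i < l, h (i + 1) = h i + 1 ∨ h i = h (i + 1) + 1) (close : h l = h 0) :
    Odd m ∧ m ≤ l ∧
      (l = m → (∀ i < l, h (i + 1) = h i + 1) ∨ (∀ i < l, h i = h (i + 1) + 1)) := by
  classical
  set s : ℕ → ℤ := fun i => if h (i + 1) = h i + 1 then 1 else -1 with hs
  have hs1 : ∀ i, s i = 1 ∨ s i = -1 := by
    intro i
    simp only [hs]
    split_ifs <;> simp
  have hstep : ∀ i < l, h (i + 1) = h i + (s i : ZMod m) := by
    intro i hi
    simp only [hs]
    split_ifs with h1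
    · simpa using h1
    · rcases step i hi with h2 | h2
      · exact absurd h2 h1
      · rw [h2]
        push_cast
        ring
  have hsum : ∀ j ≤ l, h j = h 0 + ((∑ i ∈ Finset.range j, s i : ℤ) : ZMod m) := by
    intro j
    induction j with
    | zero => simp
    | succ j ih =>
      intro hj
      rw [hstep j (by omega), ih (by omega), Finset.sum_range_succ]
      push_cast
      ring
  have hpar : ∀ j, (∑ i ∈ Finset.range j, s i) % 2 = (j : ℤ) % 2 := by
    intro j
    induction j with
    | zero => simp
    | succ j ih =>
      rw [Finset.sum_range_succ]
      rcases hs1 j with h1 | h1 <;> rw [h1] <;> push_cast <;> omega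
  have hbound : ∀ j, (∑ i ∈ Finset.range j, s i) ≤ j ∧ -(j : ℤ) ≤ ∑ i ∈ Finset.range j, s i := by
    intro j
    induction j with
    | zero => simp
    | succ j ih =>
      rw [Finset.sum_range_succ]
      rcases hs1 j with h1 | h1 <;> rw [h1] <;> push_cast <;> omega
  have hdvd : (m : ℤ) ∣ ∑ i ∈ Finset.range l, s i := by
    rw [← ZMod.intCast_zmod_eq_zero_iff_dvd]
    have := hsum l le_rfl
    rw [close] at this
    simpa using this.symm
  obtain ⟨q, hq⟩ := hdvd
  obtain ⟨r, hr⟩ := hl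
  have hp := hpar l
  have hb := hbound l
  set T := ∑ i ∈ Finset.range l, s i
  have hodd : T % 2 = 1 := by omega
  have hmodd : Odd m := by
    by_contra hc
    rw [Nat.not_odd_iff_even] at hc
    obtain ⟨t, ht⟩ := hc
    have : T = 2 * (t * q) := by rw [hq, ht]; push_cast; ring
    omega
  have hq0 : q ≠ 0 := by
    rintro rfl
    simp at hq
    omega
  have hle : (m : ℤ) ≤ |T| := by
    rw [hq, abs_mul, Nat.abs_cast]
    have : 1 ≤ |q| := Int.one_le_abs hq0
    nlinarith [Int.natCast_nonneg m]
  have hle' : |T| ≤ l := abs_le.mpr ⟨hb.2, hb.1⟩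
  refine ⟨hmodd, by exact_mod_cast hle.trans hle', ?_⟩
  intro hlm
  have habs : |T| = l := le_antisymm hle' (by rw [hlm]; exact hle)
  rcases abs_choice T with h1 | h1
  · left
    intro i hi
    have h2 : ∀ i ∈ Finset.range l, s i = 1 := by
      have h3 : ∑ i ∈ Finset.range l, s i = ∑ i ∈ Finset.range l, (1 : ℤ) := by
        simp only [Finset.sum_const, Finset.card_range, nsmul_eq_mul, mul_one]
        change T = l
        omega
      refine (Finset.sum_eq_sum_iff_of_le ?_).mp h3
      intro i _
      rcases hs1 i with h4 | h4 <;> omega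
    have := hstep i hi
    rw [h2 i (Finset.mem_range.mpr hi)] at this
    simpa using this
  · right
    intro i hi
    have h2 : ∀ i ∈ Finset.range l, (-1 : ℤ) = s i := by
      have h3 : ∑ i ∈ Finset.range l, (-1 : ℤ) = ∑ i ∈ Finset.range l, s i := by
        simp only [Finset.sum_const, Finset.card_range, nsmul_eq_mul]
        change _ = T
        omega
      refine (Finset.sum_eq_sum_iff_of_le ?_).mp h3
      intro i _
      rcases hs1 i with h4 | h4 <;> omega
    have := hstep i hi
    rw [← h2 i (Finset.mem_range.mpr hi)] at this
    rw [this]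
    push_cast
    ring

/-! ### Induced paths -/

/-- The list of vertices is an induced path: consecutive entries are adjacent, others are not. -/
def IndPath (G : SimpleGraph V) : List V → Prop
  | [] => True
  | [_] => True
  | x :: y :: l => G.Adj x y ∧ (∀ z ∈ l, ¬ G.Adj x z) ∧ IndPath G (y :: l)

lemma IndPath.tail {G : SimpleGraph V} {x : V} {l : List V} (h : IndPath G (x :: l)) :
    IndPath G l := by
  cases l with
  | nil => trivial
  | cons y l => exact h.2.2

lemma IndPath.adj_iff {G : SimpleGraph V} :
    ∀ {l : List V}, IndPath G l → ∀ {i j : ℕ} (hi : i < l.length) (hj : j < l.length), i < j →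
      (G.Adj l[i] l[j] ↔ j = i + 1)
  | [], _, i, _, hi, _, _ => by simp at hi
  | [_], _, i, j, hi, hj, hij => by simp at hi hj; omega
  | x :: y :: l, h, i, j, hi, hj, hij => by
    obtain ⟨h1, h2, h3⟩ := h
    rcases i with _ | i
    · rcases j with _ | _ | j
      · omega
      · simpa using h1
      · simp only [List.getElem_cons_succ, List.getElem_cons_zero]
        constructor
        · intro h4
          exact absurd h4 (h2 _ (List.getElem_mem _))
        · omega
    · rcases j with _ | j
      · omega
      · have := IndPath.adj_iff h3 (i := i) (j := j) (by simpa using hi) (by simpa using hj)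
          (by omega)
        simp only [List.getElem_cons_succ]
        rw [this]
        omega

/-- Injectivity is automatic for paths on at least four vertices: there, distinct vertices of a path
have different neighbourhoods. -/
lemma IndPath.isIndContained {G : SimpleGraph V} {l : List V} (h : IndPath G l)
    (hl : 4 ≤ l.length) : (SimpleGraph.pathGraph l.length).IsIndContained G := by
  have key : ∀ {i j : ℕ} (hi : i < l.length) (hj : j < l.length),
      G.Adj l[i] l[j] ↔ (i + 1 = j ∨ j + 1 = i) := by
    intro i j hi hj
    rcases lt_trichotomy i j with hij | hij | hij
    · rw [h.adj_iff hi hj hij]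
      omega
    · subst hij
      simp
    · rw [G.adj_comm, h.adj_iff hj hi hij]
      omega
  have hinj : ∀ {i j : ℕ} (hi : i < l.length) (hj : j < l.length), i < j → l[i] ≠ l[j] := by
    intro i j hi hj hij he
    by_cases h0 : i = 0
    · by_cases h1 : j + 1 < l.length
      · have h2 := (key hj h1).mpr (by omega)
        rw [← he, key hi h1] at h2
        omega
      · have h2 := (key (i := i) (j := i + 1) hi (by omega)).mpr (by omega)
        rw [he, key hj (by omega)] at h2
        omega
    · have h2 := (key (i := i - 1) (j := i) (by omega) hi).mpr (by omega)
      rw [he, key (by omega) hj] at h2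
      omega
  refine ⟨⟨⟨fun i => l[i.1], ?_⟩, ?_⟩⟩
  · intro i j hij
    rcases lt_trichotomy i.1 j.1 with h1 | h1 | h1
    · exact absurd hij (hinj i.2 j.2 h1)
    · exact Fin.ext h1
    · exact absurd hij.symm (hinj j.2 i.2 h1)
  · intro i j
    simp only [SimpleGraph.pathGraph_adj]
    exact key i.2 j.2

lemma IndPath.length_lt {G : SimpleGraph V} {k : ℕ} (hk : 4 ≤ k)
    (hP : IndFree (SimpleGraph.pathGraph k) G) :
    ∀ {l : List V}, IndPath G l → l.length < k
  | [], _ => by simp; omega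
  | x :: l, h => by
    have h1 := IndPath.length_lt hk hP h.tail
    rcases Nat.lt_or_ge (x :: l).length k with h2 | h2
    · exact h2
    · have h3 : (x :: l).length = k := by simp at h2 ⊢; omega
      exact absurd (h3 ▸ h.isIndContained (by omega)) hP

/-! ### Induced cycles -/

/-- `c` runs through an induced cycle of length `n`. -/
def IndCycle (G : SimpleGraph V) {n : ℕ} (c : ZMod n → V) : Prop :=
  ∀ i j, G.Adj (c i) (c j) ↔ j = i + 1 ∨ i = j + 1

/-- A shortest odd closed walk is an induced cycle. -/
lemma exists_shortest_odd_cycle {G : SimpleGraph V} (hG : ¬ G.Colorable 2) :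
    ∃ n, Odd n ∧ 3 ≤ n ∧ (∀ u (w : G.Walk u u), Odd w.length → n ≤ w.length) ∧
      ∃ c : ZMod n → V, IndCycle G c := by
  classical
  have hex : ∃ n, ∃ u, ∃ w : G.Walk u u, Odd w.length ∧ w.length = n := by
    rw [SimpleGraph.two_colorable_iff_forall_loop_even] at hG
    push Not at hG
    obtain ⟨u, w, hw⟩ := hG
    exact ⟨_, u, w, by simpa using hw, rfl⟩
  obtain ⟨u, w, hodd, hlen⟩ := Nat.find_spec hex
  have hmin : ∀ u (w : G.Walk u u), Odd w.length → Nat.find hex ≤ w.length :=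
    fun u w hw => Nat.find_min' hex ⟨u, w, hw, rfl⟩
  set n := Nat.find hex with hn
  rw [hlen] at hodd
  have hn1 : n ≠ 1 := by
    intro h1
    have h2 := w.adj_getVert_succ (i := 0) (by omega)
    have h3 : w.getVert (0 + 1) = u := by
      have := w.getVert_length
      rwa [hlen, h1] at this
    rw [h3, w.getVert_zero] at h2
    exact G.loopless.irrefl _ h2
  have hn3 : 3 ≤ n := by
    obtain ⟨r, hr⟩ := hodd
    omega
  refine ⟨n, hodd, hn3, hmin, ?_⟩
  set s : ℕ → V := fun i => w.getVert (i % n) with hs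
  have hper : ∀ i, s (i + n) = s i := by
    intro i
    simp [hs]
  have hsadj : ∀ i, G.Adj (s i) (s (i + 1)) := by
    intro i
    have hi : i % n < n := Nat.mod_lt _ (by omega)
    have h1 := w.adj_getVert_succ (i := i % n) (by omega)
    have h2 : w.getVert (i % n + 1) = s (i + 1) := by
      simp only [hs]
      rcases Nat.lt_or_ge (i % n + 1) n with h3 | h3
      · rw [Nat.add_mod, Nat.mod_eq_of_lt (a := 1) (by omega), Nat.mod_eq_of_lt h3]
      · have h4 : i % n + 1 = n := by omega
        have h5 : (i + 1) % n = 0 := by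
          rw [Nat.add_mod, Nat.mod_eq_of_lt (a := 1) (by omega), h4, Nat.mod_self]
        rw [h4, h5, w.getVert_zero, ← hlen, w.getVert_length]
    rw [h2] at h1
    exact h1
  have hwalk : ∀ i j l, i + l = j → ∃ p : G.Walk (s i) (s j), p.length = l := by
    rintro i _ l rfl
    induction l with
    | zero => exact ⟨SimpleGraph.Walk.nil, rfl⟩
    | succ l ih =>
      obtain ⟨p, hp⟩ := ih
      refine ⟨p.append (SimpleGraph.Walk.cons (hsadj (i + l)) SimpleGraph.Walk.nil), ?_⟩
      simp [hp]
  have hchord : ∀ p q, p < q → q < n → G.Adj (s p) (s q) → q = p + 1 ∨ (p = 0 ∧ q + 1 = n) := by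
    intro p q hpq hq hadj
    obtain ⟨w1, h1⟩ := hwalk p q (q - p) (by omega)
    obtain ⟨w2, h2⟩ := hper p ▸ hwalk q (p + n) (n + p - q) (by omega)
    have m1 := hmin _ (SimpleGraph.Walk.cons hadj.symm w1)
    have m2 := hmin _ (SimpleGraph.Walk.cons hadj w2)
    simp only [SimpleGraph.Walk.length_cons, h1, h2] at m1 m2
    rcases Nat.even_or_odd (q - p + 1) with h3 | h3
    · have h4 : Odd (n + p - q + 1) := by
        obtain ⟨r, hr⟩ := h3
        obtain ⟨r', hr'⟩ := hodd
        exact ⟨r' + 1 - r, by omega⟩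
      have := m2 h4
      omega
    · have := m1 h3
      omega
  have : NeZero n := ⟨by omega⟩
  refine ⟨fun i => s i.val, ?_⟩
  have hcast : ∀ i : ℕ, s ((i : ZMod n)).val = s i := by
    intro i
    simp [hs, ZMod.val_natCast]
  have hval : ∀ i j : ZMod n, i.val < j.val → G.Adj (s i.val) (s j.val) →
      j = i + 1 ∨ i = j + 1 := by
    intro i j hij hadj
    rcases hchord _ _ hij (ZMod.val_lt j) hadj with h1 | ⟨h1, h2⟩
    · left
      rw [← ZMod.natCast_zmod_val j, h1]
      simp
    · right
      rw [← ZMod.natCast_zmod_val j, ← ZMod.natCast_zmod_val i, h1]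
      have : ((j.val + 1 : ℕ) : ZMod n) = 0 := by rw [h2]; simp
      push_cast at this
      simpa using this.symm
  have hnext : ∀ i : ZMod n, G.Adj (s i.val) (s (i + 1).val) := by
    intro i
    have h1 := hsadj i.val
    rw [← hcast (i.val + 1)] at h1
    simpa using h1
  intro i j
  constructor
  · intro hadj
    rcases lt_trichotomy i.val j.val with h1 | h1 | h1
    · exact hval i j h1 hadj
    · rw [ZMod.val_injective n h1] at hadj
      exact absurd hadj (G.loopless.irrefl _)
    · exact (hval j i h1 hadj.symm).symm
  · rintro (rfl | rfl)
    · exact hnext i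
    · exact (hnext j).symm

/-- `len` consecutive vertices of the cycle `c`, beginning with `c b`. -/
def arc {n : ℕ} (c : ZMod n → V) : ZMod n → ℕ → List V
  | _, 0 => []
  | b, len + 1 => c b :: arc c (b + 1) len

@[simp] lemma length_arc {n : ℕ} (c : ZMod n → V) (b : ZMod n) (len : ℕ) :
    (arc c b len).length = len := by
  induction len generalizing b with
  | zero => rfl
  | succ len ih => simp [arc, ih]

lemma mem_arc {n : ℕ} {c : ZMod n → V} {b : ZMod n} {len : ℕ} {v : V} :
    v ∈ arc c b len ↔ ∃ i < len, v = c (b + i) := by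
  induction len generalizing b with
  | zero => simp [arc]
  | succ len ih =>
    simp only [arc, List.mem_cons, ih]
    constructor
    · rintro (h | ⟨i, hi, h⟩)
      · exact ⟨0, by omega, by simpa using h⟩
      · exact ⟨i + 1, by omega, by rw [h]; push_cast; ring_nf⟩
    · rintro ⟨i, hi, h⟩
      rcases i with _ | i
      · left; simpa using h
      · right
        exact ⟨i, by omega, by rw [h]; push_cast; ring_nf⟩

lemma natCast_ne_zero_of_lt {n i : ℕ} (h0 : 0 < i) (h : i < n) : (i : ZMod n) ≠ 0 := by
  rw [Ne, ZMod.natCast_eq_zero_iff]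
  exact Nat.not_dvd_of_pos_of_lt h0 h

lemma IndCycle.indPath_arc {G : SimpleGraph V} {n : ℕ} {c : ZMod n → V} (hc : IndCycle G c)
    (b : ZMod n) {len : ℕ} (hlen : len + 1 ≤ n) : IndPath G (arc c b len) := by
  induction len generalizing b with
  | zero => trivial
  | succ len ih =>
    rcases len with _ | len
    · trivial
    · refine ⟨(hc _ _).mpr (Or.inl rfl), ?_, ih (b + 1) (by omega)⟩
      intro z hz hadj
      obtain ⟨i, hi, rfl⟩ := mem_arc.mp hz
      rcases (hc _ _).mp hadj with h | h
      · have : ((i + 1 : ℕ) : ZMod n) = 0 := by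
          push_cast
          linear_combination h
        exact natCast_ne_zero_of_lt (by omega) (by omega) this
      · have : ((i + 3 : ℕ) : ZMod n) = 0 := by
          push_cast
          linear_combination -h
        exact natCast_ne_zero_of_lt (by omega) (by omega) this

/-- A vertex followed by a nonempty induced path of which it sees exactly the first vertex. -/
lemma IndPath.cons {G : SimpleGraph V} {x y : V} {l : List V} (h : IndPath G (y :: l))
    (hxy : G.Adj x y) (hl : ∀ z ∈ l, ¬ G.Adj x z) : IndPath G (x :: y :: l) :=
  ⟨hxy, hl, h⟩

/-! ### Minimal obstructions -/

/-- `G` is `P_k`-free and not `C_{k-2}`-colourable, but every proper induced subgraph is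
`C_{k-2}`-colourable. -/
structure Critical (G : SimpleGraph V) (k : ℕ) : Prop where
  free : IndFree (SimpleGraph.pathGraph k) G
  not_col : ¬ ∃ f : V → ZMod (k - 2), ColOn G Set.univ f
  sub_col : ∀ S : Set V, S ≠ Set.univ → ∃ f : V → ZMod (k - 2), ColOn G S f

lemma critical_of_isIndMinimal {k : ℕ} (hk : 4 < k) {G : SimpleGraph V}
    (hG : IsIndMinimal (fun _ G' => IndFree (SimpleGraph.pathGraph k) G' ∧
      ¬ HColorable (SimpleGraph.cycleGraph (k - 2)) G') G) : Critical G k := by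
  obtain ⟨⟨h1, h2⟩, h3⟩ := hG
  refine ⟨h1, fun h => h2 ((hColorable_iff (by omega) G).mpr h), fun S hS => ?_⟩
  rw [← hColorable_induce_iff (by omega)]
  by_contra hc
  exact h3 S hS ⟨fun h => h1 (h.trans ⟨SimpleGraph.Embedding.induce S⟩), hc⟩

namespace Critical

variable {G : SimpleGraph V} {k : ℕ}

lemma eq_univ (hG : Critical G k) {S : Set V} (hS : ¬ ∃ f : V → ZMod (k - 2), ColOn G S f) :
    S = Set.univ := by
  by_contra h
  exact hS (hG.sub_col S h)

/-- A colouring outside `S` would extend along a map that moves the vertices of `S` out of `S` and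
preserves all edges at `S`. -/
lemma exists_not_adj_of_fold (hG : Critical G k) {S : Set V} (hS : S.Nonempty) (φ : V → V)
    (h1 : ∀ s ∈ S, φ s ∉ S) (h2 : ∀ s ∈ S, ∀ t ∈ S, G.Adj s t → G.Adj (φ s) (φ t)) :
    ∃ s ∈ S, ∃ t, t ∉ S ∧ G.Adj s t ∧ ¬ G.Adj (φ s) t := by
  classical
  by_contra hcon
  push Not at hcon
  obtain ⟨f, hf⟩ := hG.sub_col Sᶜ (by simpa [Set.nonempty_iff_ne_empty] using hS)
  refine hG.not_col ⟨fun v => if v ∈ S then f (φ v) else f v, ?_⟩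
  intro x _ y _ hxy
  by_cases hx : x ∈ S <;> by_cases hy : y ∈ S <;> simp only [hx, hy, if_true, if_false]
  · exact hf (h1 x hx) (h1 y hy) (h2 x hx y hy hxy)
  · exact hf (h1 x hx) hy (hcon x hx y hy hxy)
  · exact hf hx (h1 y hy) (hcon y hy x hx hxy.symm).symm
  · exact hf hx hy hxy

lemma exists_adj_not_adj (hG : Critical G k) {x y : V} (hxy : x ≠ y) :
    ∃ t, G.Adj x t ∧ ¬ G.Adj y t := by
  obtain ⟨s, hs, t, -, h1, h2⟩ := hG.exists_not_adj_of_fold (S := {x}) ⟨x, rfl⟩ (fun _ => y)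
    (fun _ _ => hxy.symm) (by rintro s rfl t rfl h; exact absurd h (G.loopless.irrefl _))
  rw [Set.mem_singleton_iff] at hs
  exact ⟨t, hs ▸ h1, h2⟩

/-- A minimal obstruction is connected. -/
lemma exists_adj_compl (hG : Critical G k) {S : Set V} (hS : S.Nonempty) (hS' : S ≠ Set.univ) :
    ∃ x ∈ S, ∃ y, y ∉ S ∧ G.Adj x y := by
  classical
  by_contra hcon
  push Not at hcon
  obtain ⟨f, hf⟩ := hG.sub_col S hS'
  obtain ⟨g, hg⟩ := hG.sub_col Sᶜ (by simpa [Set.nonempty_iff_ne_empty] using hS)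
  refine hG.not_col ⟨fun v => if v ∈ S then f v else g v, ?_⟩
  intro x _ y _ hxy
  by_cases hx : x ∈ S <;> by_cases hy : y ∈ S <;> simp only [hx, hy, if_true, if_false]
  · exact hf hx hy hxy
  · exact absurd hxy (hcon x hx y hy)
  · exact absurd hxy.symm (hcon y hy x hx)
  · exact hg hx hy hxy

lemma not_colorable_two (hG : Critical G k) : ¬ G.Colorable 2 := by
  rintro ⟨φ⟩
  refine hG.not_col ⟨fun v => if φ v = 0 then 0 else 1, ?_⟩
  intro x _ y _ hxy
  have h := φ.valid hxy
  have h1 : φ x = 0 ∨ φ x = 1 := by omega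
  have h2 : φ y = 0 ∨ φ y = 1 := by omega
  rcases h1 with h1 | h1 <;> rcases h2 with h2 | h2 <;> simp_all

end Critical

/-! ### Small residues -/

lemma ofNat_ne_zero_of_odd {n : ℕ} (hn : Odd n) (h5 : 5 ≤ n) :
    (1 : ZMod n) ≠ 0 ∧ (2 : ZMod n) ≠ 0 ∧ (3 : ZMod n) ≠ 0 ∧ (4 : ZMod n) ≠ 0 ∧
      (6 : ZMod n) ≠ 0 ∧ (8 : ZMod n) ≠ 0 := by
  have key : ∀ t : ℕ, ¬ n ∣ t → (t : ZMod n) ≠ 0 := by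
    intro t ht h
    exact ht ((ZMod.natCast_eq_zero_iff t n).mp h)
  have hlt : ∀ t, 0 < t → t < n → ¬ n ∣ t := fun t h0 h => Nat.not_dvd_of_pos_of_lt h0 h
  obtain ⟨r, hr⟩ := hn
  have h6 : ¬ n ∣ 6 := by
    rcases Nat.lt_or_ge 6 n with h | h
    · exact hlt 6 (by omega) h
    · obtain rfl : n = 5 := by omega
      decide
  have h8 : ¬ n ∣ 8 := by
    rcases Nat.lt_or_ge 8 n with h | h
    · exact hlt 8 (by omega) h
    · have : n = 5 ∨ n = 7 := by omega
      rcases this with rfl | rfl <;> decide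
  exact ⟨by exact_mod_cast key 1 (hlt 1 (by omega) (by omega)),
    by exact_mod_cast key 2 (hlt 2 (by omega) (by omega)),
    by exact_mod_cast key 3 (hlt 3 (by omega) (by omega)),
    by exact_mod_cast key 4 (hlt 4 (by omega) (by omega)),
    by exact_mod_cast key 6 h6, by exact_mod_cast key 8 h8⟩

/-! ### Odd girth `k` -/

section

variable {G : SimpleGraph V} {n : ℕ} {c : ZMod n → V}

lemma IndCycle.exists_walk (hc : IndCycle G c) (b : ZMod n) (l : ℕ) :
    ∃ p : G.Walk (c b) (c (b + l)), p.length = l := by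
  induction l with
  | zero => exact ⟨SimpleGraph.Walk.nil.copy rfl (by simp), by simp⟩
  | succ l ih =>
    obtain ⟨p, hp⟩ := ih
    have h : G.Adj (c (b + l)) (c (b + (l + 1 : ℕ))) := (hc _ _).mpr (Or.inl (by push_cast; ring))
    exact ⟨p.append (SimpleGraph.Walk.cons h SimpleGraph.Walk.nil), by simp [hp]⟩

/-- A walk between two vertices of a shortest odd cycle, closed up along either side of the cycle,
has even length or length at least `n`. -/
lemma IndCycle.walk_length (hc : IndCycle G c) [NeZero n]
    (hmin : ∀ u (w : G.Walk u u), Odd w.length → n ≤ w.length) {i j : ZMod n}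
    (w : G.Walk (c i) (c j)) :
    (Odd (w.length + (j - i).val) → n ≤ w.length + (j - i).val) ∧
      (Odd (w.length + (n - (j - i).val)) → n ≤ w.length + (n - (j - i).val)) := by
  have hd := ZMod.val_lt (j - i)
  obtain ⟨p, hp⟩ := hc.exists_walk i (j - i).val
  obtain ⟨q, hq⟩ := hc.exists_walk j (n - (j - i).val)
  constructor
  · have h := hmin _ (w.append (p.copy rfl (by simp)).reverse)
    simpa [hp] using h
  · have h := hmin _ (w.append (q.copy rfl (by
      rw [Nat.cast_sub hd.le]
      simp)))
    simpa [hq] using h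

lemma IndCycle.sub_of_walk_two (hc : IndCycle G c) (hn : Odd n) (hn5 : 5 ≤ n)
    (hmin : ∀ u (w : G.Walk u u), Odd w.length → n ≤ w.length) {i j : ZMod n} {v : V}
    (h1 : G.Adj (c i) v) (h2 : G.Adj v (c j)) : j = i ∨ j = i + 2 ∨ j = i - 2 := by
  have : NeZero n := ⟨by omega⟩
  obtain ⟨h3, h4⟩ := hc.walk_length hmin (SimpleGraph.Walk.cons h1 (SimpleGraph.Walk.cons h2 .nil))
  simp only [SimpleGraph.Walk.length_cons, SimpleGraph.Walk.length_nil] at h3 h4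
  have hd := ZMod.val_lt (j - i)
  have hji : ((j - i).val : ZMod n) = j - i := ZMod.natCast_zmod_val _
  obtain ⟨r, hr⟩ := hn
  set d := (j - i).val
  rcases Nat.even_or_odd d with ⟨t, ht⟩ | ⟨t, ht⟩
  · have h5 := h4 ⟨r + 1 - t, by omega⟩
    have : d = 0 ∨ d = 2 := by omega
    rcases this with h | h <;> rw [h] at hji <;> push_cast at hji
    · left; linear_combination -hji
    · right; left; linear_combination -hji
  · have h5 := h3 ⟨t + 1, by omega⟩
    have h6 : d + 2 = n := by omega
    have h7 : ((d + 2 : ℕ) : ZMod n) = 0 := by rw [h6]; simp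
    push_cast at h7
    right; right; linear_combination -hji + h7

lemma IndCycle.sub_of_walk_three (hc : IndCycle G c) (hn : Odd n) (hn5 : 5 ≤ n)
    (hmin : ∀ u (w : G.Walk u u), Odd w.length → n ≤ w.length) {i j : ZMod n} {u v : V}
    (h1 : G.Adj (c i) u) (huv : G.Adj u v) (h2 : G.Adj v (c j)) :
    j = i + 1 ∨ j = i - 1 ∨ j = i + 3 ∨ j = i - 3 := by
  have : NeZero n := ⟨by omega⟩
  obtain ⟨h3, h4⟩ := hc.walk_length hmin
    (SimpleGraph.Walk.cons h1 (SimpleGraph.Walk.cons huv (SimpleGraph.Walk.cons h2 .nil)))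
  simp only [SimpleGraph.Walk.length_cons, SimpleGraph.Walk.length_nil] at h3 h4
  have hd := ZMod.val_lt (j - i)
  have hji : ((j - i).val : ZMod n) = j - i := ZMod.natCast_zmod_val _
  obtain ⟨r, hr⟩ := hn
  set d := (j - i).val
  rcases Nat.even_or_odd d with ⟨t, ht⟩ | ⟨t, ht⟩
  · have h5 := h3 ⟨t + 1, by omega⟩
    have : d + 1 = n ∨ d + 3 = n := by omega
    rcases this with h | h
    · have h7 : ((d + 1 : ℕ) : ZMod n) = 0 := by rw [h]; simp
      push_cast at h7
      right; left; linear_combination -hji + h7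
    · have h7 : ((d + 3 : ℕ) : ZMod n) = 0 := by rw [h]; simp
      push_cast at h7
      right; right; right; linear_combination -hji + h7
  · have h5 := h4 ⟨r + 1 - t, by omega⟩
    have : d = 1 ∨ d = 3 := by omega
    rcases this with h | h <;> rw [h] at hji <;> push_cast at hji
    · left; linear_combination -hji
    · right; right; left; linear_combination -hji

end

/-- The cycle of length `m + 2` folds onto the cycle of length `m`. -/
lemma exists_fold_labels {m : ℕ} (hm : 2 ≤ m) :
    ∃ g : ZMod (m + 2) → ZMod m, ∀ i, g (i + 1) = g i + 1 ∨ g i = g (i + 1) + 1 := by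
  have : NeZero (m + 2) := ⟨by omega⟩
  refine ⟨fun i => if i.val = m + 1 then 1 else (i.val : ZMod m), ?_⟩
  intro i
  have hi := ZMod.val_lt i
  have hv : (i + 1).val = if i.val = m + 1 then 0 else i.val + 1 := by
    have h1 : (1 : ZMod (m + 2)).val = 1 := ZMod.val_one'' (by omega)
    rw [ZMod.val_add, h1]
    split_ifs with h
    · rw [h]
      simp
    · exact Nat.mod_eq_of_lt (by omega)
  by_cases h1 : i.val = m + 1
  · right
    simp [hv, h1]
  by_cases h2 : i.val = m
  · left
    simp [hv, h2]
  · left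
    simp [hv, h1, h2]

/-- If a shortest odd closed walk had length `k`, every vertex would be adjacent to both neighbours
of some vertex of the cycle. So the graph would map to the cycle of length `k`, which folds onto the
cycle of length `k - 2`. -/
lemma Critical.not_shortest_odd_cycle_eq {G : SimpleGraph V} {k : ℕ} (hk : 4 < k)
    (hG : Critical G k) (hodd : Odd k)
    (hmin : ∀ u (w : G.Walk u u), Odd w.length → k ≤ w.length) {c : ZMod k → V}
    (hc : IndCycle G c) : False := by
  obtain ⟨e1, e2, e3, e4, e6, e8⟩ := ofNat_ne_zero_of_odd hodd (by omega)
  have two : ∀ {i j : ZMod k} {v : V}, G.Adj (c i) v → G.Adj v (c j) →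
      j = i ∨ j = i + 2 ∨ j = i - 2 := fun h1 h2 => hc.sub_of_walk_two hodd (by omega) hmin h1 h2
  -- Otherwise `v` and all but one of the vertices of the cycle form an induced path.
  have attach : ∀ v i, G.Adj v (c i) → ∃ a, G.Adj v (c (a + 1)) ∧ G.Adj v (c (a - 1)) := by
    intro v i hv
    by_contra hcon
    push Not at hcon
    have hpath : IndPath G (v :: arc c i (k - 1)) := by
      obtain ⟨l, hl⟩ : ∃ l, k - 1 = l + 1 := ⟨k - 2, by omega⟩
      rw [hl]
      have harc := hc.indPath_arc i (len := l + 1) (by omega)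
      refine harc.cons hv ?_
      intro z hz hadj
      obtain ⟨t, ht, rfl⟩ := mem_arc.mp hz
      rcases two hv.symm hadj with h | h | h
      · have : ((t + 1 : ℕ) : ZMod k) = 0 := by push_cast; linear_combination h
        exact natCast_ne_zero_of_lt (by omega) (by omega) this
      · refine hcon (i + 1) ?_ (by simpa using hv)
        rw [h] at hadj
        convert hadj using 2
        ring
      · refine hcon (i - 1) (by simpa using hv) ?_
        rw [h] at hadj
        convert hadj using 2
        ring
    have := IndPath.length_lt (by omega) hG.free hpath
    simp at this
    omega
  have only : ∀ v a, G.Adj v (c (a + 1)) → G.Adj v (c (a - 1)) → ∀ j, G.Adj v (c j) →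
      j = a + 1 ∨ j = a - 1 := by
    intro v a h1 h2 j h3
    have h4 := two h1.symm h3
    have h5 := two h2.symm h3
    grind
  have all : ∀ v, ∃ i, G.Adj v (c i) := by
    by_contra hcon
    push Not at hcon
    obtain ⟨w0, hw0⟩ := hcon
    obtain ⟨v, ⟨i, hi⟩, w, hw, hvw⟩ := hG.exists_adj_compl (S := {v | ∃ i, G.Adj v (c i)})
      ⟨c 0, 1, (hc _ _).mpr (Or.inl (by simp))⟩
      (fun h => by
        have : w0 ∈ {v | ∃ i, G.Adj v (c i)} := h ▸ Set.mem_univ _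
        obtain ⟨i, hi⟩ := this
        exact hw0 i hi)
    obtain ⟨a, ha1, ha2⟩ := attach v i hi
    have hw' : ∀ i, ¬ G.Adj w (c i) := fun i h => hw ⟨i, h⟩
    have hpath : IndPath G (w :: v :: arc c (a + 1) (k - 2)) := by
      obtain ⟨l, hl⟩ : ∃ l, k - 2 = l + 1 := ⟨k - 3, by omega⟩
      rw [hl]
      have harc := hc.indPath_arc (a + 1) (len := l + 1) (by omega)
      have h1 : IndPath G (v :: arc c (a + 1) (l + 1)) := by
        refine harc.cons ha1 ?_
        intro z hz hadj
        obtain ⟨t, ht, rfl⟩ := mem_arc.mp hz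
        rcases only v a ha1 ha2 _ hadj with h | h
        · have : ((t + 1 : ℕ) : ZMod k) = 0 := by push_cast; linear_combination h
          exact natCast_ne_zero_of_lt (by omega) (by omega) this
        · have : ((t + 3 : ℕ) : ZMod k) = 0 := by push_cast; linear_combination h
          exact natCast_ne_zero_of_lt (by omega) (by omega) this
      refine h1.cons hvw.symm ?_
      intro z hz
      obtain ⟨t, ht, rfl⟩ := mem_arc.mp hz
      exact hw' _
    have := IndPath.length_lt (by omega) hG.free hpath
    simp at this
    omega
  have pos : ∀ v, ∃ a, G.Adj v (c (a + 1)) ∧ G.Adj v (c (a - 1)) := fun v =>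
    (all v).elim fun i hi => attach v i hi
  choose a ha1 ha2 using pos
  obtain ⟨m, rfl⟩ : ∃ m, k = m + 2 := ⟨k - 2, by omega⟩
  obtain ⟨g, hg⟩ := exists_fold_labels (m := m) (by omega)
  refine hG.not_col ⟨fun v => g (a v), ?_⟩
  intro x _ y _ hxy
  have three : ∀ {i j : ZMod (m + 2)}, G.Adj x (c i) → G.Adj y (c j) → 
      j = i + 1 ∨ j = i - 1 ∨ j = i + 3 ∨ j = i - 3 := fun h1 h2 =>
    hc.sub_of_walk_three hodd (by omega) hmin h1.symm hxy h2
  have h1 := three (ha1 x) (ha1 y)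
  have h2 := three (ha1 x) (ha2 y)
  have h3 := three (ha2 x) (ha1 y)
  have h4 : a y = a x + 1 ∨ a x = a y + 1 := by grind
  rcases h4 with h4 | h4
  · show g (a y) = g (a x) + 1 ∨ g (a x) = g (a y) + 1
    rw [h4]
    exact hg _
  · show g (a y) = g (a x) + 1 ∨ g (a x) = g (a y) + 1
    rw [h4]
    exact (hg _).symm

/-! ### Large obstructions containing a shortest odd cycle of length `k - 2 ≥ 5` -/

/-- `f` is a labelling of `S` and the cycle `c` that is the identity on the cycle. -/
structure Good {m : ℕ} (G : SimpleGraph V) (c : ZMod m → V) (S : Finset V) (f : V → ZMod m) :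
    Prop where
  base : ∀ i, f (c i) = i
  col : ColOn G (↑S ∪ Set.range c) f

/-- The situation of a minimal obstruction that has more than `3 * k + 28` vertices and contains an
induced cycle `c` of length `m = k - 2 ≥ 5`. No vertex dominates another one, and every set that is
too small to be everything has a labelling, normalised on the cycle. -/
structure LargeObstruction {m : ℕ} (G : SimpleGraph V) (c : ZMod m → V) : Prop where
  odd : Odd m
  five : 5 ≤ m
  length_lt : ∀ {l : List V}, IndPath G l → l.length < m + 2
  cycle : IndCycle G c
  not_col : ¬ ∃ f : V → ZMod m, ColOn G Set.univ f
  dominated : ∀ {x y : V}, x ≠ y → ∃ t, G.Adj x t ∧ ¬ G.Adj y t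
  connected : ∀ {S : Set V}, S.Nonempty → S ≠ Set.univ → ∃ x ∈ S, ∃ y, y ∉ S ∧ G.Adj x y
  small : ∀ S : Finset V, S.card ≤ 2 * m + 22 → ∃ f, Good G c S f

section

variable {G : SimpleGraph V} {m : ℕ} {c : ZMod m → V}

namespace Good

variable {S : Finset V} {f : V → ZMod m}

lemma mono {T : Finset V} (h : Good G c T f) (hST : S ⊆ T) : Good G c S f :=
  ⟨h.base, h.col.mono (Set.union_subset_union_left _ (by exact_mod_cast hST))⟩

lemma adj (h : Good G c S f) {x y : V} (hx : x ∈ S) (hy : y ∈ S) (hxy : G.Adj x y) :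
    f y = f x + 1 ∨ f x = f y + 1 :=
  h.col (Or.inl hx) (Or.inl hy) hxy

lemma adj_cycle (h : Good G c S f) {x : V} (hx : x ∈ S) {i : ZMod m} (hxi : G.Adj x (c i)) :
    i = f x + 1 ∨ f x = i + 1 := by
  have := h.col (Or.inl hx) (Or.inr ⟨i, rfl⟩) hxi
  rwa [h.base] at this

end Good

lemma not_adj_of_mem_arc {b : ZMod m} {len : ℕ} {v : V}
    (hv : ∀ i, G.Adj v (c i) → ∃ r : ℕ, 0 < r ∧ r + len ≤ m ∧ i = b - r) :
    ∀ z ∈ arc c b len, ¬ G.Adj v z := by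
  intro z hz hadj
  obtain ⟨t, ht, rfl⟩ := mem_arc.mp hz
  obtain ⟨r, hr, hrl, h⟩ := hv _ hadj
  refine natCast_ne_zero_of_lt (n := m) (i := t + r) (by omega) (by omega) ?_
  push_cast
  linear_combination h

namespace LargeObstruction

variable (hG : LargeObstruction G c)
include hG

lemma ne_zero : (1 : ZMod m) ≠ 0 ∧ (2 : ZMod m) ≠ 0 ∧ (3 : ZMod m) ≠ 0 ∧ (4 : ZMod m) ≠ 0 ∧
    (6 : ZMod m) ≠ 0 ∧ (8 : ZMod m) ≠ 0 :=
  ofNat_ne_zero_of_odd hG.odd hG.five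

lemma cycle_nbrs {v : V} {i j : ZMod m} (hi : G.Adj v (c i)) (hj : G.Adj v (c j)) :
    j = i ∨ j = i + 2 ∨ j = i - 2 := by
  obtain ⟨f, hf⟩ := hG.small {v} (by simp)
  have h1 := hf.adj_cycle (Finset.mem_singleton_self v) hi
  have h2 := hf.adj_cycle (Finset.mem_singleton_self v) hj
  grind

lemma cycle_nbrs_of_two {v : V} {a i : ZMod m} (h1 : G.Adj v (c (a - 1)))
    (h2 : G.Adj v (c (a + 1))) (hi : G.Adj v (c i)) : i = a - 1 ∨ i = a + 1 := by
  obtain ⟨e1, e2, e3, e4, e6, e8⟩ := hG.ne_zero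
  have h3 := hG.cycle_nbrs h1 hi
  have h4 := hG.cycle_nbrs h2 hi
  rcases h3 with h | h | h
  · exact Or.inl h
  · right
    linear_combination h
  · rcases h4 with h' | h' | h'
    · exact Or.inr h'
    · exact absurd (by linear_combination h - h') e6
    · left
      linear_combination h'

lemma triangle_free {x y z : V} (hxy : G.Adj x y) (hyz : G.Adj y z) : ¬ G.Adj x z := by
  classical
  intro hxz
  obtain ⟨e1, e2, e3, e4, e6, e8⟩ := hG.ne_zero
  obtain ⟨f, hf⟩ := hG.small {x, y, z} (Finset.card_le_three.trans (by omega))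
  have h1 := hf.adj (by simp) (by simp) hxy
  have h2 := hf.adj (by simp) (by simp) hyz
  have h3 := hf.adj (by simp) (by simp) hxz
  grind

/-- A vertex attached to the cycle that sees an edge away from the cycle sees the cycle twice. -/
lemma exists_two_of_edge {x y u : V} {i : ZMod m} (hx : ∀ i, ¬ G.Adj x (c i))
    (hy : ∀ i, ¬ G.Adj y (c i)) (hxy : G.Adj y x) (hu : G.Adj u (c i)) (hux : G.Adj u x) :
    ∃ a, G.Adj u (c (a - 1)) ∧ G.Adj u (c (a + 1)) := by
  by_contra hcon
  push Not at hcon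
  have hm := hG.five
  obtain ⟨l, rfl⟩ : ∃ l, m = l + 2 := ⟨m - 2, by omega⟩
  have hpath : IndPath G (y :: x :: u :: arc c i (l + 1)) := by
    have harc : IndPath G (arc c i (l + 1)) := hG.cycle.indPath_arc i (by omega)
    refine (((harc.cons hu ?_).cons hux.symm ?_).cons hxy ?_)
    · intro z hz hadj
      obtain ⟨t, ht, rfl⟩ := mem_arc.mp hz
      rcases hG.cycle_nbrs hu hadj with h | h | h
      · refine natCast_ne_zero_of_lt (n := l + 2) (i := t + 1) (by omega) (by omega) ?_
        push_cast
        linear_combination h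
      · refine hcon (i + 1) (by simpa using hu) ?_
        rw [h] at hadj
        convert hadj using 2
        ring
      · refine hcon (i - 1) ?_ (by simpa using hu)
        rw [h] at hadj
        convert hadj using 2
        ring
    · exact not_adj_of_mem_arc (b := i) (len := l + 1) (fun i hi => absurd hi (hx i))
    · intro z hz hadj
      rcases List.mem_cons.mp hz with rfl | hz
      · exact hG.triangle_free hadj.symm hxy hux
      · exact not_adj_of_mem_arc (b := i) (len := l + 1) (fun i hi => absurd hi (hy i)) z hz hadj
  have := hG.length_lt hpath
  simp at this

/-- Vertices away from the cycle that are joined by a path of length two away from the cycle have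
the same attached neighbours. -/
lemma adj_of_path {x y z u : V} {i : ZMod m} (hx : ∀ i, ¬ G.Adj x (c i))
    (hy : ∀ i, ¬ G.Adj y (c i)) (hz : ∀ i, ¬ G.Adj z (c i)) (hzy : G.Adj z y) (hyx : G.Adj y x)
    (hu : G.Adj u (c i)) (hux : G.Adj u x) : G.Adj u z := by
  by_contra hcon
  have hm := hG.five
  obtain ⟨a, h1, h2⟩ := hG.exists_two_of_edge hx hy hyx hu hux
  obtain ⟨l, rfl⟩ : ∃ l, m = l + 3 := ⟨m - 3, by omega⟩
  have hpath : IndPath G (z :: y :: x :: u :: arc c (a + 1) (l + 1)) := by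
    have harc : IndPath G (arc c (a + 1) (l + 1)) := hG.cycle.indPath_arc (a + 1) (by omega)
    refine ((((harc.cons h2 ?_).cons hux.symm ?_).cons
      hyx ?_).cons hzy ?_)
    · refine not_adj_of_mem_arc fun i hi => ?_
      rcases hG.cycle_nbrs_of_two h1 h2 hi with rfl | rfl
      · refine ⟨3, by omega, by omega, ?_⟩
        push_cast
        ring
      · refine ⟨1, by omega, by omega, ?_⟩
        push_cast
        ring
    · exact not_adj_of_mem_arc (b := a + 1) (len := l + 1) (fun i hi => absurd hi (hx i))
    · intro w hw hadj
      rcases List.mem_cons.mp hw with rfl | hw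
      · exact hG.triangle_free hadj.symm hyx hux
      · exact not_adj_of_mem_arc (b := a + 1) (len := l + 1) (fun i hi => absurd hi (hy i)) w hw
          hadj
    · intro w hw hadj
      rcases List.mem_cons.mp hw with rfl | hw
      · exact hG.triangle_free hzy hyx hadj
      rcases List.mem_cons.mp hw with rfl | hw
      · exact hcon hadj.symm
      · exact not_adj_of_mem_arc (b := a + 1) (len := l + 1) (fun i hi => absurd hi (hz i)) w hw
          hadj
  have := hG.length_lt hpath
  simp at this

/-- Every vertex is at distance at most two from the cycle. -/
lemma exists_adj_attached (v : V) : ∃ u, G.Adj v u ∧ ∃ i, G.Adj u (c i) := by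
  classical
  by_contra hcon
  push Not at hcon
  have hv : v ∈ {x | ∀ u, G.Adj x u → ∀ i, ¬ G.Adj u (c i)} := hcon
  -- The vertices all of whose neighbours miss the cycle form a union of components.
  obtain ⟨x, hx, y, hy, hxy⟩ := hG.connected ⟨v, hv⟩ (fun h => by
    have h0 : c 0 ∈ {x | ∀ u, G.Adj x u → ∀ i, ¬ G.Adj u (c i)} := h ▸ Set.mem_univ _
    refine h0 (c 1) ((hG.cycle _ _).mpr (Or.inl (by ring))) 2
      ((hG.cycle _ _).mpr (Or.inl (by ring))))
  simp only [Set.mem_ofPred_eq] at hx hy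
  push Not at hy
  obtain ⟨u, hyu, i, hu⟩ := hy
  have hxc : ∀ i, ¬ G.Adj x (c i) := fun i h =>
    hx _ h (i + 1) ((hG.cycle _ _).mpr (Or.inl rfl))
  obtain ⟨t, hxt, hut⟩ := hG.dominated (x := x) (y := u) (fun h => hxc i (h ▸ hu))
  exact hut (hG.adj_of_path (hx y hxy) hxc (hx t hxt) hxt.symm hxy hu hyu.symm)

end LargeObstruction

/-- `v` gets the label `x` in every normalised labelling of some small set. -/
def Forced (G : SimpleGraph V) (c : ZMod m → V) (v : V) (x : ZMod m) : Prop :=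
  ∃ S : Finset V, S.card ≤ 6 ∧ v ∈ S ∧ ∀ f, Good G c S f → f v = x

/-- The reason why a vertex `v` behaves like the vertex `c a` of the cycle: the two labels available
to it are `a - 1` and `a + 1`, unless its label is forced. -/
inductive Center (G : SimpleGraph V) (c : ZMod m → V) (v : V) (a : ZMod m) : Prop
  /-- `v` is attached to the cycle. -/
  | attached : G.Adj v (c a) → Center G c v a
  /-- `v` has a neighbour that is attached to both sides of `c a`. -/
  | linked (p : V) : G.Adj v p → G.Adj p (c (a - 1)) → G.Adj p (c (a + 1)) → Center G c v a
  /-- All neighbours of `v` are attached, some of them to either side of `c a`. -/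
  | split (p q : V) : (∀ y, G.Adj v y → ∃ i, G.Adj y (c i)) →
      G.Adj v p → G.Adj v q → G.Adj p (c (a - 1)) → G.Adj q (c (a + 1)) → Center G c v a
  /-- Two neighbours of `v` are attached to vertices of the cycle at distance four. -/
  | wide (p q : V) : G.Adj v p → G.Adj v q → G.Adj p (c (a - 1)) → G.Adj q (c (a + 3)) →
      Center G c v a

namespace LargeObstruction

variable (hG : LargeObstruction G c)
include hG

/-- If the neighbours of `v` are attached to a single vertex of the cycle each, this is not the same
one for all of them, as it would dominate `v`. -/
lemma exists_center (v : V) : ∃ a, Center G c v a := by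
  classical
  by_cases hv : ∃ i, G.Adj v (c i)
  · exact hv.imp fun i hi => .attached hi
  push Not at hv
  by_cases htwo : ∃ p a, G.Adj v p ∧ G.Adj p (c (a - 1)) ∧ G.Adj p (c (a + 1))
  · obtain ⟨p, a, h1, h2, h3⟩ := htwo
    exact ⟨a, .linked p h1 h2 h3⟩
  obtain ⟨p, hvp, i, hpi⟩ := hG.exists_adj_attached v
  have hatt : ∀ y, G.Adj v y → ∃ j, G.Adj y (c j) := by
    by_contra hcon
    push Not at hcon
    obtain ⟨y, hvy, hy⟩ := hcon
    obtain ⟨a, h2, h3⟩ := hG.exists_two_of_edge hv hy hvy.symm hpi hvp.symm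
    exact htwo ⟨p, a, hvp, h2, h3⟩
  obtain ⟨q, hvq, hq⟩ := hG.dominated (x := v) (y := c i)
    (fun h => hv (i + 1) (h ▸ (hG.cycle _ _).mpr (Or.inl rfl)))
  obtain ⟨j, hqj⟩ := hatt q hvq
  have hij : j ≠ i := fun h => hq (h ▸ hqj.symm)
  obtain ⟨f, hf⟩ := hG.small {v, p, q} (Finset.card_le_three.trans (by omega))
  have h1 := hf.adj (by simp) (by simp) hvp
  have h2 := hf.adj (by simp) (by simp) hvq
  have h3 := hf.adj_cycle (by simp) hpi
  have h4 := hf.adj_cycle (by simp) hqj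
  have h5 : j = i + 2 ∨ i = j + 2 ∨ j = i + 4 ∨ i = j + 4 := by grind
  rcases h5 with rfl | rfl | rfl | rfl
  · exact ⟨i + 1, .split p q hatt hvp hvq (by simpa using hpi)
      (by convert hqj using 2; ring)⟩
  · exact ⟨j + 1, .split q p hatt hvq hvp (by simpa using hqj)
      (by convert hpi using 2; ring)⟩
  · exact ⟨i + 1, .wide p q hvp hvq (by simpa using hpi) (by convert hqj using 2; ring)⟩
  · exact ⟨j + 1, .wide q p hvq hvp (by simpa using hqj) (by convert hpi using 2; ring)⟩

/-- In a normalised labelling of a small set, the label of `v` is one of the neighbours of its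
centre. -/
lemma exists_support {v : V} {a : ZMod m} (h : Center G c v a) :
    ∃ S : Finset V, S.card ≤ 3 ∧ v ∈ S ∧ ∀ f, Good G c S f → f v = a + 1 ∨ f v = a - 1 := by
  classical
  obtain ⟨e1, e2, e3, e4, e6, e8⟩ := hG.ne_zero
  rcases h with h1 | ⟨p, h1, h2, h3⟩ | ⟨p, q, -, h1, h2, h3, h4⟩ | ⟨p, q, h1, h2, h3, h4⟩
  · refine ⟨{v}, by simp, by simp, fun f hf => ?_⟩
    have := hf.adj_cycle (by simp) h1
    grind
  · refine ⟨{v, p}, Finset.card_le_two.trans (by omega), by simp, fun f hf => ?_⟩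
    have h1 := hf.adj (by simp) (by simp) h1
    have h2 := hf.adj_cycle (by simp) h2
    have h3 := hf.adj_cycle (by simp) h3
    grind
  all_goals
    refine ⟨{v, p, q}, Finset.card_le_three, by simp, fun f hf => ?_⟩
    have h1 := hf.adj (by simp) (by simp) h1
    have h2 := hf.adj (by simp) (by simp) h2
    have h3 := hf.adj_cycle (by simp) h3
    have h4 := hf.adj_cycle (by simp) h4
    grind

lemma forced_of_wide {v p q : V} {a : ZMod m} (h1 : G.Adj v p) (h2 : G.Adj v q)
    (h3 : G.Adj p (c (a - 1))) (h4 : G.Adj q (c (a + 3))) : Forced G c v (a + 1) := by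
  classical
  obtain ⟨e1, e2, e3, e4, e6, e8⟩ := hG.ne_zero
  refine ⟨{v, p, q}, Finset.card_le_three.trans (by omega), by simp, fun f hf => ?_⟩
  have h1 := hf.adj (by simp) (by simp) h1
  have h2 := hf.adj (by simp) (by simp) h2
  have h3 := hf.adj_cycle (by simp) h3
  have h4 := hf.adj_cycle (by simp) h4
  grind

/-- The centres of adjacent vertices differ by one, or by three, in which case both vertices are
forced. -/
lemma center_sub {v w : V} {a b : ZMod m} (hv : Center G c v a) (hw : Center G c w b)
    (hvw : G.Adj v w) : b = a + 1 ∨ a = b + 1 ∨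
      (b = a + 3 ∧ Forced G c v (a + 1) ∧ Forced G c w (b - 1)) ∨
      (a = b + 3 ∧ Forced G c v (a - 1) ∧ Forced G c w (b + 1)) := by
  classical
  obtain ⟨e1, e2, e3, e4, e6, e8⟩ := hG.ne_zero
  obtain ⟨S, hS, hvS, hSv⟩ := hG.exists_support hv
  obtain ⟨T, hT, hwT, hTw⟩ := hG.exists_support hw
  have hcard : (S ∪ T).card ≤ 6 := (Finset.card_union_le _ _).trans (by omega)
  have key : ∀ f, Good G c (S ∪ T) f → (f v = a + 1 ∨ f v = a - 1) ∧
      (f w = b + 1 ∨ f w = b - 1) ∧ (f w = f v + 1 ∨ f v = f w + 1) := fun f hf =>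
    ⟨hSv f (hf.mono Finset.subset_union_left), hTw f (hf.mono Finset.subset_union_right),
      hf.adj (by simp [hvS]) (by simp [hwT]) hvw⟩
  have hab : b = a + 1 ∨ a = b + 1 ∨ b = a + 3 ∨ a = b + 3 := by
    obtain ⟨f, hf⟩ := hG.small (S ∪ T) (by omega)
    obtain ⟨h1, h2, h3⟩ := key f hf
    grind
  rcases hab with h | h | h | h
  · exact Or.inl h
  · exact Or.inr (Or.inl h)
  · refine Or.inr (Or.inr (Or.inl ⟨h, ⟨S ∪ T, hcard, by simp [hvS], fun f hf => ?_⟩,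
      ⟨S ∪ T, hcard, by simp [hwT], fun f hf => ?_⟩⟩)) <;>
    · obtain ⟨h1, h2, h3⟩ := key f hf
      grind
  · refine Or.inr (Or.inr (Or.inr ⟨h, ⟨S ∪ T, hcard, by simp [hvS], fun f hf => ?_⟩,
      ⟨S ∪ T, hcard, by simp [hwT], fun f hf => ?_⟩⟩)) <;>
    · obtain ⟨h1, h2, h3⟩ := key f hf
      grind

end LargeObstruction

/-! ### Chains of implications -/

lemma indPath_map_range' {p : ℕ → V} {len : ℕ} : ∀ {b : ℕ},
    (∀ i, b ≤ i → i + 1 < b + len → G.Adj (p i) (p (i + 1))) →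
    (∀ i j, b ≤ i → i + 1 < j → j < b + len → ¬ G.Adj (p i) (p j)) →
    IndPath G ((List.range' b len).map p) := by
  induction len with
  | zero => intros; trivial
  | succ len ih =>
    intro b h1 h2
    have h3 := @ih (b + 1) (fun i hi hi' => h1 i (by omega) (by omega))
      (fun i j hi hij hj => h2 i j (by omega) hij (by omega))
    rcases len with _ | len
    · trivial
    · refine IndPath.cons h3 (h1 b le_rfl (by omega)) ?_
      intro z hz
      obtain ⟨j, hj, rfl⟩ := List.mem_map.mp hz
      rw [List.mem_range'_1] at hj
      exact h2 b j le_rfl (by omega) (by omega)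

/-- The label of `v` is not determined by a small set. -/
def Unforced (G : SimpleGraph V) (c : ZMod m → V) (v : V) (a : ZMod m) : Prop :=
  ¬ Forced G c v (a - 1) ∧ ¬ Forced G c v (a + 1)

/-- A chain of implications. Each of the vertices `p 0, …, p t`, with centres given by `a`, must get
the lower of its two labels if its predecessor does; `p 0` must get the lower label, but `p t` must
get the upper one. -/
structure Chain (G : SimpleGraph V) (c : ZMod m → V) (a : V → ZMod m) (t : ℕ) (p : ℕ → V) :
    Prop where
  low : Forced G c (p 0) (a (p 0) - 1)
  high : Forced G c (p t) (a (p t) + 1)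
  adj : ∀ i < t, G.Adj (p i) (p (i + 1))
  center : ∀ i < t, a (p (i + 1)) = a (p i) + 1

namespace LargeObstruction

variable (hG : LargeObstruction G c)
include hG

/-- If no chain of implications led to a conflict, giving the lower label to the vertices reached by
such chains, and the upper label to the others, would be a labelling. -/
lemma exists_chain {a : V → ZMod m} (ha : ∀ v, Center G c v (a v)) : ∃ t p, Chain G c a t p := by
  classical
  by_contra hcon
  push Not at hcon
  let Low : V → Prop := fun v => ∃ (t : ℕ) (p : ℕ → V), Forced G c (p 0) (a (p 0) - 1) ∧ p t = v ∧
    (∀ i < t, G.Adj (p i) (p (i + 1))) ∧ ∀ i < t, a (p (i + 1)) = a (p i) + 1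
  have low_of_forced : ∀ v, Forced G c v (a v - 1) → Low v := fun v hv =>
    ⟨0, fun _ => v, hv, rfl, by simp, by simp⟩
  have high : ∀ v, Forced G c v (a v + 1) → ¬ Low v := by
    rintro v hv ⟨t, p, h0, rfl, h1, h2⟩
    exact hcon t p ⟨h0, hv, h1, h2⟩
  have step : ∀ v w, G.Adj v w → a w = a v + 1 → Low v → Low w := by
    rintro v w hvw haw ⟨t, p, h0, rfl, h1, h2⟩
    have hq : ∀ i ≤ t, (if i ≤ t then p i else w) = p i := fun i hi => if_pos hi
    have hq' : (if t + 1 ≤ t then p (t + 1) else w) = w := if_neg (by omega)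
    refine ⟨t + 1, fun i => if i ≤ t then p i else w, ?_, hq', ?_, ?_⟩
    · simpa using h0
    all_goals
      intro i hi
      simp only
      rw [hq i (by omega)]
      rcases Nat.lt_or_ge i t with h | h
      · rw [hq (i + 1) h]
        first | exact h1 i h | exact h2 i h
      · obtain rfl : i = t := by omega
        rw [hq']
        assumption
  refine hG.not_col ⟨fun v => if Low v then a v - 1 else a v + 1, ?_⟩
  have main : ∀ x y, G.Adj x y → (a y = a x + 1 ∨ a y = a x + 3 ∧
      Forced G c x (a x + 1) ∧ Forced G c y (a y - 1)) →
      ((if Low y then a y - 1 else a y + 1) = (if Low x then a x - 1 else a x + 1) + 1 ∨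
      (if Low x then a x - 1 else a x + 1) = (if Low y then a y - 1 else a y + 1) + 1) := by
    rintro x y hxy (h | ⟨h, hx, hy⟩)
    · by_cases hx : Low x
      · rw [if_pos hx, if_pos (step x y hxy h hx), h]
        left; ring
      · rw [if_neg hx, h]
        split_ifs
        · right; ring
        · left; ring
    · rw [if_neg (high x hx), if_pos (low_of_forced y hy), h]
      left; ring
  intro x _ y _ hxy
  rcases hG.center_sub (ha x) (ha y) hxy with h | h | h | ⟨h1, h2, h3⟩
  · exact main x y hxy (Or.inl h)
  · exact (main y x hxy.symm (Or.inl h)).symm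
  · exact main x y hxy (Or.inr h)
  · exact (main y x hxy.symm (Or.inr ⟨h1, h3, h2⟩)).symm

/-- Every other vertex of the cycle that `v` is adjacent to would force the label of `v`. -/
lemma cycle_nbr_of_unforced {v : V} {a j : ZMod m} (hv : Center G c v a) (hf : Unforced G c v a)
    (hj : G.Adj v (c j)) : j = a := by
  obtain ⟨e1, e2, e3, e4, e6, e8⟩ := hG.ne_zero
  obtain ⟨S, hS, hvS, hSv⟩ := hG.exists_support hv
  have hja : j = a ∨ j = a + 2 ∨ j = a - 2 := by
    obtain ⟨f, hf⟩ := hG.small S (by omega)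
    have h1 := hSv f hf
    have h2 := hf.adj_cycle hvS hj
    grind
  rcases hja with h | h | h
  · exact h
  · refine absurd ⟨S, by omega, hvS, fun f hf => ?_⟩ hf.2
    have h1 := hSv f hf
    have h2 := hf.adj_cycle hvS hj
    grind
  · refine absurd ⟨S, by omega, hvS, fun f hf => ?_⟩ hf.1
    have h1 := hSv f hf
    have h2 := hf.adj_cycle hvS hj
    grind

/-- A vertex `q` that is attached to both sides of `c s` has the label `s`, which restricts the
centres of its unforced neighbours. -/
lemma center_ne_of_adj_two {v q : V} {b s : ZMod m} (hv : Center G c v b) (hu : Unforced G c v b)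
    (hvq : G.Adj v q) (h2 : G.Adj q (c (s - 1))) (h3 : G.Adj q (c (s + 1))) :
    b ≠ s - 1 ∧ b ≠ s - 2 := by
  classical
  obtain ⟨e1, e2, e3, e4, e6, e8⟩ := hG.ne_zero
  obtain ⟨S, hS, hvS, hSv⟩ := hG.exists_support hv
  have hcard : (insert q S).card ≤ 6 := (Finset.card_insert_le _ _).trans (by omega)
  have hval : ∀ f, Good G c (insert q S) f → (s - 1 = f q + 1 ∨ f q = s - 1 + 1) ∧
      (s + 1 = f q + 1 ∨ f q = s + 1 + 1) ∧ (f v = b + 1 ∨ f v = b - 1) ∧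
      (f q = f v + 1 ∨ f v = f q + 1) := fun f hf =>
    ⟨hf.adj_cycle (by simp) h2, hf.adj_cycle (by simp) h3,
      hSv f (hf.mono (Finset.subset_insert _ _)), hf.adj (by simp [hvS]) (by simp) hvq⟩
  constructor
  · intro hb
    obtain ⟨f, hf⟩ := hG.small (insert q S) (by omega)
    obtain ⟨h4, h5, h6, h7⟩ := hval f hf
    grind
  · intro hb
    refine hu.2 ⟨insert q S, hcard, by simp [hvS], fun f hf => ?_⟩
    obtain ⟨h4, h5, h6, h7⟩ := hval f hf
    grind

/-- A path of five vertices, continued along the cycle, is an induced path on `m + 2` vertices. -/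
lemma not_hook {x y z w q : V} {s : ZMod m} (hxy : G.Adj x y) (hyz : G.Adj y z) (hzw : G.Adj z w)
    (hwq : G.Adj w q) (hxz : ¬ G.Adj x z) (hxw : ¬ G.Adj x w) (hyw : ¬ G.Adj y w)
    (hxq : ¬ G.Adj x q) (hyq : ¬ G.Adj y q) (hzq : ¬ G.Adj z q)
    (hx : ∀ j, G.Adj x (c j) → j = s - 1) (hy : ∀ j, G.Adj y (c j) → j = s - 2)
    (hz : ∀ j, G.Adj z (c j) → j = s - 1) (hw : ∀ j, G.Adj w (c j) → j = s)
    (hq : G.Adj q (c (s + 1))) (hq' : ∀ j, G.Adj q (c j) → j = s - 1 ∨ j = s + 1) : False := by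
  have hm := hG.five
  obtain ⟨l, rfl⟩ : ∃ l, m = l + 4 := ⟨m - 4, by omega⟩
  have harc : IndPath G (arc c (s + 1) (l + 1)) := hG.cycle.indPath_arc (s + 1) (by omega)
  have off : ∀ {v : V} (r : ℕ), 0 < r → r ≤ 3 → (∀ j, G.Adj v (c j) → j = s + 1 - r) →
      ∀ z ∈ arc c (s + 1) (l + 1), ¬ G.Adj v z := fun r h0 h3 hv =>
    not_adj_of_mem_arc fun i hi => ⟨r, h0, by omega, hv i hi⟩
  have hpath : IndPath G (x :: y :: z :: w :: q :: arc c (s + 1) (l + 1)) := by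
    refine ((((harc.cons hq ?_).cons hwq ?_).cons hzw ?_).cons hyz ?_).cons hxy ?_
    · refine not_adj_of_mem_arc fun i hi => ?_
      rcases hq' i hi with rfl | rfl
      · refine ⟨3, by omega, by omega, ?_⟩
        push_cast
        ring
      · refine ⟨1, by omega, by omega, ?_⟩
        push_cast
        ring
    · exact off 1 (by omega) (by omega) fun j hj => by rw [hw j hj]; push_cast; ring
    · intro v hv
      rcases List.mem_cons.mp hv with rfl | hv
      · exact hzq
      · exact off 2 (by omega) (by omega) (fun j hj => by rw [hz j hj]; push_cast; ring) v hv
    · intro v hv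
      rcases List.mem_cons.mp hv with rfl | hv
      · exact hyw
      rcases List.mem_cons.mp hv with rfl | hv
      · exact hyq
      · exact off 3 (by omega) (by omega) (fun j hj => by rw [hy j hj]; push_cast; ring) v hv
    · intro v hv
      rcases List.mem_cons.mp hv with rfl | hv
      · exact hxz
      rcases List.mem_cons.mp hv with rfl | hv
      · exact hxw
      rcases List.mem_cons.mp hv with rfl | hv
      · exact hxq
      · exact off 2 (by omega) (by omega) (fun j hj => by rw [hx j hj]; push_cast; ring) v hv
  have := hG.length_lt hpath
  simp at this

end LargeObstruction

namespace Chain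

variable {a : V → ZMod m} {t : ℕ} {p : ℕ → V} (hp : Chain G c a t p)
include hp

lemma center_eq {i j : ℕ} (hij : i ≤ j) (hj : j ≤ t) : a (p j) = a (p i) + (j - i : ℕ) := by
  induction j, hij using Nat.le_induction with
  | base => simp
  | succ j hij ih =>
    rw [hp.center j (by omega), ih (by omega), Nat.succ_sub hij]
    push_cast
    ring

variable (hmin : ∀ t' p', Chain G c a t' p' → t ≤ t')
include hmin

lemma unforced {i : ℕ} (h0 : 0 < i) (hi : i < t) : Unforced G c (p i) (a (p i)) := by
  constructor
  · intro h
    have := hmin (t - i) (fun j => p (i + j)) ⟨h, by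
      rw [Nat.add_sub_cancel' hi.le]
      exact hp.high, fun j hj => hp.adj (i + j) (by omega),
      fun j hj => hp.center (i + j) (by omega)⟩
    omega
  · intro h
    have := hmin i p ⟨hp.low, h, fun j hj => hp.adj j (by omega),
      fun j hj => hp.center j (by omega)⟩
    omega

/-- A shortest chain has no shortcuts. -/
lemma eq_succ_of_adj {i j : ℕ} (hij : i < j) (hj : j ≤ t) (hadj : G.Adj (p i) (p j))
    (hc : a (p j) = a (p i) + 1) : j = i + 1 := by
  by_contra hne
  have hle : ∀ s ≤ i, (if s ≤ i then p s else p (s + (j - i - 1))) = p s := fun s hs => if_pos hs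
  have hgt : ∀ s, ¬ s ≤ i → (if s ≤ i then p s else p (s + (j - i - 1))) = p (s + (j - i - 1)) :=
    fun s hs => if_neg hs
  have hstep : ∀ s < t - (j - i - 1),
      G.Adj (if s ≤ i then p s else p (s + (j - i - 1)))
        (if s + 1 ≤ i then p (s + 1) else p (s + 1 + (j - i - 1))) ∧
      a (if s + 1 ≤ i then p (s + 1) else p (s + 1 + (j - i - 1))) =
        a (if s ≤ i then p s else p (s + (j - i - 1))) + 1 := by
    intro s hs
    rcases Nat.lt_trichotomy s i with h | rfl | h
    · rw [hle s h.le, hle (s + 1) h]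
      exact ⟨hp.adj s (by omega), hp.center s (by omega)⟩
    · rw [hle s le_rfl, hgt (s + 1) (by omega), show s + 1 + (j - s - 1) = j by omega]
      exact ⟨hadj, hc⟩
    · rw [hgt s (by omega), hgt (s + 1) (by omega),
        show s + 1 + (j - i - 1) = s + (j - i - 1) + 1 by omega]
      exact ⟨hp.adj _ (by omega), hp.center _ (by omega)⟩
  have := hmin (t - (j - i - 1)) (fun s => if s ≤ i then p s else p (s + (j - i - 1)))
    ⟨by simpa using hp.low, by
      rw [hgt _ (by omega), show t - (j - i - 1) + (j - i - 1) = t by omega]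
      exact hp.high, fun s hs => (hstep s hs).1, fun s hs => (hstep s hs).2⟩
  omega

end Chain

namespace LargeObstruction

variable (hG : LargeObstruction G c)
include hG

/-- In a shortest chain, chords of the interior join vertices at distance `-1` modulo `m`. -/
lemma chord {a : V → ZMod m} (ha : ∀ v, Center G c v (a v)) {t : ℕ} {p : ℕ → V}
    (hp : Chain G c a t p) (hmin : ∀ t' p', Chain G c a t' p' → t ≤ t') {i j : ℕ} (h0 : 0 < i)
    (hij : i + 1 < j) (hj : j < t) (hadj : G.Adj (p i) (p j)) : m ∣ j - i + 1 := by
  have hu := hp.unforced hmin h0 (by omega)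
  rcases hG.center_sub (ha _) (ha _) hadj with h | h | ⟨-, h, -⟩ | ⟨-, h, -⟩
  · have := hp.eq_succ_of_adj hmin (by omega) hj.le hadj h
    omega
  · rw [← ZMod.natCast_eq_zero_iff]
    have := hp.center_eq (i := i) (j := j) (by omega) hj.le
    push_cast
    linear_combination -this - h
  · exact absurd h hu.2
  · exact absurd h hu.1

/-- A shortest chain is short, since a long one contains, together with a part of the cycle, an
induced path on `m + 2` vertices. -/
lemma chain_length_lt {a : V → ZMod m} (ha : ∀ v, Center G c v (a v)) {t : ℕ} {p : ℕ → V}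
    (hp : Chain G c a t p) (hmin : ∀ t' p', Chain G c a t' p' → t ≤ t') : t < m + 6 := by
  classical
  obtain ⟨e1, e2, e3, e4, e6, e8⟩ := hG.ne_zero
  have hm := hG.five
  by_contra hlt
  have hun : ∀ i, 0 < i → i < t → Unforced G c (p i) (a (p i)) := fun i h0 hi =>
    hp.unforced hmin h0 hi
  have hcyc : ∀ i, 0 < i → i < t → ∀ j, G.Adj (p i) (c j) → j = a (p i) := fun i h0 hi j hj =>
    hG.cycle_nbr_of_unforced (ha _) (hun i h0 hi) hj
  -- The vertices `p 1, …, p (m + 2)` do not form an induced path.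
  obtain ⟨i, hi1, hi3, hi⟩ : ∃ i, 1 ≤ i ∧ i ≤ 3 ∧ G.Adj (p i) (p (i + m - 1)) := by
    by_contra hcon
    push Not at hcon
    have h := hG.length_lt (indPath_map_range' (G := G) (p := p) (b := 1) (len := m + 2)
      (fun i _ _ => hp.adj i (by omega)) (fun i j h1 h2 h3 hadj => by
        obtain ⟨r, hr⟩ := hG.chord ha hp hmin h1 h2 (by omega) hadj
        have : r = 1 := by
          rcases r with _ | _ | r
          · omega
          · rfl
          · have : m * (r + 1 + 1) = m * r + 2 * m := by ring
            omega
        subst this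
        refine hcon i h1 (by omega) ?_
        convert hadj using 2
        omega))
    simp at h
  have hxy := hi
  have hyz := hp.adj (i + m - 1) (by omega)
  have hzw := hp.adj (i + m) (by omega)
  rw [show i + m - 1 + 1 = i + m by omega] at hyz
  have hnot : ∀ j j', i ≤ j → j + 1 < j' → j' < t → j' - j + 1 < 2 * m → j' - j + 1 ≠ m →
      ¬ G.Adj (p j) (p j') := by
    intro j j' h1 h2 h3 h4 h5 hadj
    obtain ⟨r, hr⟩ := hG.chord ha hp hmin (by omega) h2 h3 hadj
    rcases r with _ | _ | r
    · omega
    · omega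
    · have : m * (r + 1 + 1) = m * r + 2 * m := by ring
      omega
  set s := a (p (i + m + 1)) with hs
  have hmm : ((m : ℕ) : ZMod m) = 0 := ZMod.natCast_self m
  have hx : a (p i) = s - 1 := by
    have := hp.center_eq (i := i) (j := i + m + 1) (by omega) (by omega)
    rw [show i + m + 1 - i = m + 1 by omega] at this
    push_cast at this
    linear_combination -this - hmm
  have hz : a (p (i + m)) = s - 1 := by
    linear_combination -hp.center (i + m) (by omega)
  have hy : a (p (i + m - 1)) = s - 2 := by
    have := hp.center (i + m - 1) (by omega)
    rw [show i + m - 1 + 1 = i + m by omega] at this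
    linear_combination hz - this
  -- The reason for the centre of `p (i + m + 1)` leads from this vertex to the cycle.
  have hq : ∃ q, G.Adj (p (i + m + 1)) q ∧ ¬ G.Adj (p i) q ∧ ¬ G.Adj (p (i + m - 1)) q ∧
      ¬ G.Adj (p (i + m)) q ∧ G.Adj q (c (s + 1)) ∧
      ∀ j, G.Adj q (c j) → j = s - 1 ∨ j = s + 1 := by
    rcases ha (p (i + m + 1)) with h1 | ⟨q, h1, h2, h3⟩ | ⟨q, q', h1, -⟩ |
      ⟨q, q', h1, h2, h3, h4⟩
    · refine ⟨c s, h1, ?_, ?_, ?_, (hG.cycle _ _).mpr (Or.inl rfl), ?_⟩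
      · intro h
        have := hcyc i (by omega) (by omega) _ h
        exact e1 (by linear_combination this + hx)
      · intro h
        have := hcyc (i + m - 1) (by omega) (by omega) _ h
        exact e2 (by linear_combination this + hy)
      · intro h
        have := hcyc (i + m) (by omega) (by omega) _ h
        exact e1 (by linear_combination this + hz)
      · intro j hj
        rcases (hG.cycle _ _).mp hj with h | h
        · exact Or.inr h
        · left
          linear_combination -h
    · have key : ∀ j, 0 < j → j < t → G.Adj (p j) q → a (p j) ≠ s - 1 ∧ a (p j) ≠ s - 2 :=
        fun j h0 hj h => hG.center_ne_of_adj_two (ha _) (hun j h0 hj) h h2 h3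
      refine ⟨q, h1, fun h => ?_, fun h => ?_, fun h => ?_, h3, fun j hj =>
        hG.cycle_nbrs_of_two h2 h3 hj⟩
      · exact (key _ (by omega) (by omega) h).1 hx
      · exact (key _ (by omega) (by omega) h).2 hy
      · exact (key _ (by omega) (by omega) h).1 hz
    · have hwv := hp.adj (i + m + 1) (by omega)
      have hcv := hp.center (i + m + 1) (by omega)
      obtain ⟨j, hj⟩ := h1 _ hwv
      have honly := hcyc (i + m + 1 + 1) (by omega) (by omega)
      have hj' := honly j hj
      refine ⟨p (i + m + 1 + 1), hwv, ?_, ?_, ?_, ?_, ?_⟩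
      · exact hnot i _ le_rfl (by omega) (by omega) (by omega) (by omega)
      · exact hnot _ _ (by omega) (by omega) (by omega) (by omega) (by omega)
      · exact hnot _ _ (by omega) (by omega) (by omega) (by omega) (by omega)
      · rwa [hj', hcv] at hj
      · intro j hj
        right
        rw [honly j hj, hcv]
    · exact absurd (hG.forced_of_wide h1 h2 h3 h4) (hun _ (by omega) (by omega)).2
  obtain ⟨q, hwq, hxq, hyq, hzq, hq1, hq2⟩ := hq
  refine hG.not_hook (s := s) hxy hyz hzw hwq ?_ ?_ ?_ hxq hyq hzq ?_ ?_ ?_ ?_ hq1 hq2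
  · exact hnot _ _ (by omega) (by omega) (by omega) (by omega) (by omega)
  · exact hnot _ _ (by omega) (by omega) (by omega) (by omega) (by omega)
  · exact hnot _ _ (by omega) (by omega) (by omega) (by omega) (by omega)
  · exact fun j hj => (hcyc _ (by omega) (by omega) j hj).trans hx
  · exact fun j hj => (hcyc _ (by omega) (by omega) j hj).trans hy
  · exact fun j hj => (hcyc _ (by omega) (by omega) j hj).trans hz
  · exact fun j hj => hcyc _ (by omega) (by omega) j hj

/-- If the predecessor of `v` in a chain gets its lower label, the label of `v` is `a - 1` or
`a - 3`. The latter is excluded by `v` and a single further vertex. -/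
lemma exists_guard {v : V} {a : ZMod m} (hv : Center G c v a) (hu : Unforced G c v a) :
    ∃ q, ∀ (S : Finset V) f, Good G c S f → v ∈ S → q ∈ S → f v ≠ a - 3 := by
  obtain ⟨e1, e2, e3, e4, e6, e8⟩ := hG.ne_zero
  rcases hv with h1 | ⟨p, h1, h2, h3⟩ | ⟨p, q, -, h1, h2, h3, h4⟩ | ⟨p, q, h1, h2, h3, h4⟩
  · refine ⟨v, fun S f hf hv _ => ?_⟩
    have := hf.adj_cycle hv h1
    grind
  · refine ⟨p, fun S f hf hv hp => ?_⟩
    have h1 := hf.adj hv hp h1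
    have h3 := hf.adj_cycle hp h3
    grind
  · refine ⟨q, fun S f hf hv hq => ?_⟩
    have h2 := hf.adj hv hq h2
    have h4 := hf.adj_cycle hq h4
    grind
  · exact absurd (hG.forced_of_wide h1 h2 h3 h4) hu.2

/-- Large obstructions do not exist: a chain of implications of length at most `m + 5` is carried by
a set of at most `2 * m + 22` vertices. -/
theorem not_exists : False := by
  classical
  obtain ⟨e1, e2, e3, e4, e6, e8⟩ := hG.ne_zero
  choose a ha using hG.exists_center
  have hex := hG.exists_chain ha
  obtain ⟨p, hp⟩ := Nat.find_spec hex
  have hmin : ∀ t' p', Chain G c a t' p' → Nat.find hex ≤ t' := fun t' p' h =>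
    Nat.find_min' hex ⟨p', h⟩
  generalize Nat.find hex = t at hp hmin
  have ht := hG.chain_length_lt ha hp hmin
  have hguard : ∀ i, ∃ q, 0 < i → i < t → ∀ (S : Finset V) f, Good G c S f → p i ∈ S → q ∈ S →
      f (p i) ≠ a (p i) - 3 := by
    intro i
    by_cases h : 0 < i ∧ i < t
    · obtain ⟨q, hq⟩ := hG.exists_guard (ha (p i)) (hp.unforced hmin h.1 h.2)
      exact ⟨q, fun _ _ => hq⟩
    · exact ⟨p i, fun h0 h1 => absurd ⟨h0, h1⟩ h⟩
  choose q hq using hguard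
  obtain ⟨S, hS, hS0, hSf⟩ := hp.low
  obtain ⟨T, hT, hTt, hTf⟩ := hp.high
  -- The forcing sets of the ends, with two vertices for each interior vertex of the chain.
  let I := Finset.Ioo 0 t
  let W := (S ∪ T) ∪ (I.image p ∪ I.image q)
  have hI : I.card = t - 0 - 1 := Nat.card_Ioo _ _
  have hW : W.card ≤ 2 * m + 22 := by
    have h1 := Finset.card_union_le (S ∪ T) (I.image p ∪ I.image q)
    have h2 := Finset.card_union_le S T
    have h3 := Finset.card_union_le (I.image p) (I.image q)
    have h4 : (I.image p).card ≤ I.card := Finset.card_image_le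
    have h5 : (I.image q).card ≤ I.card := Finset.card_image_le
    change ((S ∪ T) ∪ (I.image p ∪ I.image q)).card ≤ _
    omega
  obtain ⟨f, hf⟩ := hG.small W hW
  have hSW : S ⊆ W := Finset.subset_union_left.trans Finset.subset_union_left
  have hTW : T ⊆ W := Finset.subset_union_right.trans Finset.subset_union_left
  have hpW : ∀ i, 0 < i → i < t → p i ∈ W := fun i h0 h1 =>
    Finset.mem_union_right _ (Finset.mem_union_left _
      (Finset.mem_image_of_mem _ (Finset.mem_Ioo.mpr ⟨h0, h1⟩)))
  have hqW : ∀ i, 0 < i → i < t → q i ∈ W := fun i h0 h1 =>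
    Finset.mem_union_right _ (Finset.mem_union_right _
      (Finset.mem_image_of_mem _ (Finset.mem_Ioo.mpr ⟨h0, h1⟩)))
  have h0 : f (p 0) = a (p 0) - 1 := hSf f (hf.mono hSW)
  have h1 : f (p t) = a (p t) + 1 := hTf f (hf.mono hTW)
  have hpW' : ∀ i ≤ t, p i ∈ W := by
    intro i hi
    rcases Nat.eq_zero_or_pos i with rfl | hi0
    · exact hSW hS0
    rcases hi.eq_or_lt with rfl | hit
    · exact hTW hTt
    · exact hpW i hi0 hit
  have hlow : ∀ i < t, f (p i) = a (p i) - 1 := by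
    intro i
    induction i with
    | zero => exact fun _ => h0
    | succ i ih =>
      intro hi
      have h2 := ih (by omega)
      have h3 := hf.adj (hpW' i (by omega)) (hpW' (i + 1) hi.le) (hp.adj i (by omega))
      have h4 := hp.center i (by omega)
      have h5 := hq (i + 1) (by omega) hi W f hf (hpW' _ hi.le) (hqW _ (by omega) hi)
      rcases h3 with h3 | h3
      · linear_combination h3 + h2 - h4
      · exact absurd (by linear_combination -h3 + h2 - h4) h5
  rcases t with _ | t
  · exact e2 (by linear_combination h0 - h1)
  · have h2 := hlow t (by omega)
    have h3 := hf.adj (hpW' t (by omega)) (hpW' (t + 1) le_rfl) (hp.adj t (by omega))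
    have h4 := hp.center t (by omega)
    rcases h3 with h3 | h3
    · exact e2 (by linear_combination h3 - h1 + h2 - h4)
    · exact e4 (by linear_combination -h3 + h2 - h1 - h4)

end LargeObstruction

end

/-! ### The search for obstructions to three-colourability -/

namespace Search

/-- A vertex of a graph on the vertices `0, …, n - 1`, encoded by bit masks: `bit` is the mask of
the vertex itself and `row` is the mask of its neighbours. `tab` is the truth table, of length
`2 ^ n`, of the masks that contain the vertex. So a set of adjacency types of a further vertex is
encoded by a number, and the operations on such sets are bitwise operations. -/
structure Vtx where
  /-- the mask of the vertex -/
  bit : ℕ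
  /-- the mask of the neighbours of the vertex -/
  row : ℕ
  /-- the truth table of the masks containing the vertex -/
  tab : ℕ

/-- The bits of `a` that are not bits of `b`. -/
def diff (a b : ℕ) : ℕ := Nat.xor a (Nat.land a b)

/-- `a` if the condition holds, and `b` otherwise. The search is evaluated by the kernel. For that
reason, recursors are used here and below in place of pattern matching, and bitwise operations are
written as the functions on `ℕ` that the kernel computes natively. -/
def cond' {α : Type} (c : Bool) (a b : α) : α := Bool.rec (motive := fun _ => α) b a c

/-- The union of the sets `f v`, for the vertices `v` of the list that belong to the mask `S`. -/
def gather (S : ℕ) (f : Vtx → ℕ) (L : List Vtx) : ℕ :=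
  cond' (Nat.beq S 0) 0 (List.rec (motive := fun _ => ℕ) 0
    (fun v _ ih => cond' (Nat.beq (Nat.land v.bit S) 0) ih (Nat.lor (f v) ih)) L)

/-- Given an induced path `p q r`, the adjacency types that create an induced path on five vertices
through `p`, `q`, `r` and a fourth vertex that is adjacent to `r` or to none of the three. -/
def pathTypes (U : ℕ) (L : List Vtx) (p q r : Vtx) : ℕ :=
  Nat.lor
    (gather (diff r.row (Nat.lor p.row q.row)) (fun d =>
      Nat.lor (diff p.tab (Nat.lor q.tab (Nat.lor r.tab d.tab)))
        (diff d.tab (Nat.lor p.tab (Nat.lor q.tab r.tab)))) L)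
    (Nat.land (diff (Nat.xor p.tab r.tab) q.tab)
      (gather (diff U (Nat.lor p.row (Nat.lor q.row r.row))) Vtx.tab L))

/-- The adjacency types that create a `K₄` or an induced path on five vertices through the last
vertex `l`. -/
def forbidden (L : List Vtx) (l : Vtx) : ℕ :=
  let U := Nat.sub l.bit 1
  Nat.lor
    (gather l.row (fun b =>
      let Z := diff U (Nat.lor l.row b.row)
      Nat.lor (Nat.land (Nat.land l.tab b.tab) (gather (Nat.land l.row b.row) Vtx.tab L))
      (Nat.lor (gather (diff b.row l.row) (fun c => pathTypes U L l b c) L)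
      (Nat.lor (gather (diff l.row b.row) (fun c => pathTypes U L b l c) L)
        (Nat.land (Nat.xor l.tab b.tab)
          (gather Z (fun c => gather (Nat.land Z c.row) (fun d => diff c.tab d.tab) L) L))))) L)
    (Nat.land l.tab (gather (diff U l.row) (fun b => gather (diff b.row l.row) (fun c =>
      gather (diff c.row (Nat.lor l.row b.row)) (fun d =>
        diff b.tab (Nat.lor c.tab d.tab)) L) L) L))

/-- Whether the vertices of the list can be added to three disjoint independent sets. -/
def colorable (L : List Vtx) : ℕ → ℕ → ℕ → Bool :=
  List.rec (motive := fun _ => ℕ → ℕ → ℕ → Bool) (fun _ _ _ => true)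
    (fun v _ ih a b c =>
      cond' (cond' (Nat.beq (Nat.land v.row a) 0) (ih (Nat.lor a v.bit) b c) false) true
        (cond' (cond' (Nat.beq (Nat.land v.row b) 0) (ih a (Nat.lor b v.bit) c) false) true
          (cond' (Nat.beq (Nat.land v.row c) 0) (ih a b (Nat.lor c v.bit)) false))) L

/-- The first of two sets if it is nonempty, and otherwise the second. -/
def orElse (a b : ℕ) : ℕ := cond' (Nat.beq a 0) b a

/-- The first nonempty set `f v`, for `v` in the list. -/
def first (f : Vtx → ℕ) (L : List Vtx) : ℕ :=
  List.rec (motive := fun _ => ℕ) 0 (fun v _ ih => orElse (f v) ih) L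

/-- The first nonempty set `f v`, for `v` in the list that belong to the mask `S`. -/
def firstIn (S : ℕ) (f : Vtx → ℕ) (L : List Vtx) : ℕ :=
  first (fun v => cond' (Nat.beq (Nat.land v.bit S) 0) 0 (f v)) L

/-- `t` if the mask `a` is contained in `b`, and otherwise the empty set. -/
def ifSub (a b t : ℕ) : ℕ := cond' (Nat.beq (Nat.land a b) a) t 0

/-- If the neighbourhood of `x` is contained in that of `y`, some further vertex is adjacent to `x`
but not to `y`. -/
def vertexRule (A : List Vtx) : ℕ :=
  first (fun x => first (fun y => ifSub x.row y.row (diff x.tab y.tab)) A) (List.reverse A)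

/-- If a vertex `x` has at most two neighbours, some further vertex is adjacent to `x`. -/
def degreeRule (A : List Vtx) : ℕ :=
  first (fun x => firstIn x.row (fun a => firstIn x.row (fun b =>
    ifSub x.row (Nat.lor a.bit b.bit) x.tab) A) A) A

/-- If a triangle `x y z` can be folded to a triangle `p q r`, some further vertex forbids this. -/
def triangleRule (U : ℕ) (A : List Vtx) : ℕ :=
  first (fun x => firstIn (Nat.land x.row (Nat.sub x.bit 1)) (fun y =>
    firstIn (Nat.land (Nat.land x.row y.row) (Nat.sub y.bit 1)) (fun z =>
      firstIn (diff U (Nat.lor x.bit (Nat.lor y.bit z.bit))) (fun p =>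
        ifSub x.row (Nat.lor (Nat.lor y.bit z.bit) p.row)
          (firstIn (diff p.row (Nat.lor x.bit (Nat.lor y.bit z.bit))) (fun q =>
            ifSub y.row (Nat.lor (Nat.lor x.bit z.bit) q.row)
              (firstIn (diff (Nat.land p.row q.row) (Nat.lor x.bit (Nat.lor y.bit z.bit))) (fun r =>
                ifSub z.row (Nat.lor (Nat.lor x.bit y.bit) r.row)
                  (Nat.lor (diff x.tab p.tab) (Nat.lor (diff y.tab q.tab) (diff z.tab r.tab)))) A))
            A)) A) A) A) A

/-- A set of adjacency types one of which must occur in a minimal obstruction that properly contains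
the given graph. -/
def required (U : ℕ) (A : List Vtx) : ℕ :=
  orElse (vertexRule A) (orElse (degreeRule A) (triangleRule U A))

/-- Whether `p` holds for the members of the set `T` of masks of length `k`, each joined to `N`. The
table of length `2 ^ k` is halved repeatedly. -/
def allBits (p : ℕ → Bool) (k : ℕ) : ℕ → ℕ → Bool :=
  Nat.rec (motive := fun _ => ℕ → ℕ → Bool) (fun T N => cond' (Nat.beq T 0) true (p N))
    (fun k ih T N => cond' (Nat.beq T 0) true
      (cond' (ih (Nat.land T (Nat.sub (Nat.pow 2 (Nat.pow 2 k)) 1)) N)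
        (ih (Nat.shiftRight T (Nat.pow 2 k)) (Nat.lor N (Nat.pow 2 k))) false)) k

/-- `k` applied to the encoding of the graph with a further vertex of mask `b` and type `N`. -/
def extend (b N : ℕ) (A : List Vtx) : (List Vtx → Bool) → Bool :=
  List.rec (motive := fun _ => (List Vtx → Bool) → Bool) (fun k => k [])
    (fun v _ ih k => ih (fun A' => k (⟨v.bit,
      cond' (Nat.beq (Nat.land v.bit N) 0) v.row (Nat.lor v.row b),
      Nat.lor v.tab (Nat.shiftLeft v.tab b)⟩ :: A'))) A

/-- Whether a minimal obstruction that contains the graph with vertices `L` and last vertex `l` has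
fewer than `fuel` further vertices. The types, with respect to `L`, of the further vertices belong
to `M`. -/
def search (fuel : ℕ) : List Vtx → Vtx → ℕ → Bool :=
  Nat.rec (motive := fun _ => List Vtx → Vtx → ℕ → Bool) (fun _ _ _ => false)
    (fun _ ih L l M =>
      let A := List.append L [l]
      let b := Nat.mul 2 l.bit
      let M' := diff (Nat.lor M (Nat.shiftLeft M l.bit)) (forbidden L l)
      let R := required (Nat.sub b 1) A
      cond' (colorable (List.tail (List.tail (List.tail A))) 1 2 4)
        (cond' (Nat.beq R 0) false
          (allBits (fun N => extend b N A fun A' =>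
            ih A' ⟨b, N, Nat.shiftLeft (Nat.sub (Nat.pow 2 b) 1) b⟩ M')
            (Nat.succ (List.length L)) (Nat.land M' R) 0)) true) fuel

set_option maxRecDepth 100000 in
/-- Two triangles sharing an edge. The only type excluded in advance is that of a `K₄`. -/
lemma search_diamond :
    search 10 [⟨1, 14, 0xAAAA⟩, ⟨2, 13, 0xCCCC⟩, ⟨4, 3, 0xF0F0⟩] ⟨8, 3, 0xFF00⟩ 127 = true := by
  decide +kernel

set_option maxRecDepth 100000 in
/-- A triangle with a pendant vertex. No further vertex is adjacent to two vertices of the triangle,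
so that the types `0`, `1`, `2` and `4` remain. -/
lemma search_pendant :
    search 10 [⟨1, 14, 0xAAAA⟩, ⟨2, 5, 0xCCCC⟩, ⟨4, 3, 0xF0F0⟩] ⟨8, 1, 0xFF00⟩ 23 = true := by
  decide +kernel

lemma cond'_eq {α : Type} (c : Bool) (a b : α) : cond' c a b = if c then a else b := by
  cases c <;> rfl

lemma testBit_land (a b i : ℕ) : (Nat.land a b).testBit i = (a.testBit i && b.testBit i) :=
  Nat.testBit_and a b i

lemma testBit_lor (a b i : ℕ) : (Nat.lor a b).testBit i = (a.testBit i || b.testBit i) :=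
  Nat.testBit_or a b i

lemma testBit_nat_xor (a b i : ℕ) : (Nat.xor a b).testBit i = (a.testBit i ^^ b.testBit i) :=
  Nat.testBit_xor a b i

lemma testBit_diff (a b i : ℕ) : (diff a b).testBit i = (a.testBit i && !b.testBit i) := by
  rw [diff, testBit_nat_xor, testBit_land]
  cases a.testBit i <;> cases b.testBit i <;> rfl

lemma testBit_full (n i : ℕ) : (Nat.sub (2 ^ n) 1).testBit i = decide (i < n) :=
  Nat.testBit_two_pow_sub_one n i

lemma land_two_pow_eq_zero_iff {i S : ℕ} : Nat.land (2 ^ i) S = 0 ↔ S.testBit i = false := by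
  change 2 ^ i &&& S = 0 ↔ _
  rw [Nat.two_pow_and]
  cases S.testBit i <;> simp

lemma land_eq_left_iff {a b : ℕ} :
    Nat.land a b = a ↔ ∀ i, a.testBit i = true → b.testBit i = true := by
  constructor
  · intro h i hi
    rw [← h, testBit_land, Bool.and_eq_true] at hi
    exact hi.2
  · intro h
    refine Nat.eq_of_testBit_eq fun i => ?_
    rw [testBit_land]
    have := h i
    cases ha : a.testBit i
    · rfl
    · simp [this ha]

lemma testBit_gather {S : ℕ} {f : Vtx → ℕ} {L : List Vtx} {N : ℕ}
    (h : (gather S f L).testBit N = true) :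
    ∃ v ∈ L, Nat.land v.bit S ≠ 0 ∧ (f v).testBit N = true := by
  unfold gather at h
  rw [cond'_eq] at h
  split_ifs at h with hS
  · simp at h
  clear hS
  induction L with
  | nil => simp at h
  | cons v L ih =>
    simp only [cond'_eq] at h ih
    split_ifs at h with hv
    · obtain ⟨u, hu, h1⟩ := ih h
      exact ⟨u, List.mem_cons_of_mem _ hu, h1⟩
    · rw [testBit_lor, Bool.or_eq_true] at h
      rcases h with h | h
      · exact ⟨v, List.mem_cons_self, by simpa using hv, h⟩
      · obtain ⟨u, hu, h1⟩ := ih h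
        exact ⟨u, List.mem_cons_of_mem _ hu, h1⟩

variable (G : SimpleGraph V) (x : ℕ → V)

open Classical in
/-- The mask of the neighbours of `w` among `x 0, …, x (n - 1)`. -/
noncomputable def code (n : ℕ) (w : V) : ℕ := Nat.ofBits fun i : Fin n => decide (G.Adj w (x i))

/-- The encoding of `x i` as a vertex of the graph induced on `x 0, …, x (n - 1)`. -/
noncomputable def vert (n i : ℕ) : Vtx :=
  ⟨2 ^ i, code G x n (x i), Nat.ofBits fun N : Fin (2 ^ n) => N.val.testBit i⟩

/-- The encodings of the vertices `x 0, …, x (k - 1)`. -/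
noncomputable def verts (n k : ℕ) : List Vtx := (List.range k).map (vert G x n)

variable {G x}

lemma mem_verts {n k : ℕ} {v : Vtx} : v ∈ verts G x n k ↔ ∃ i < k, v = vert G x n i := by
  simp [verts, eq_comm]

lemma code_lt (n : ℕ) (w : V) : code G x n w < 2 ^ n := Nat.ofBits_lt_two_pow _

lemma testBit_code {n i : ℕ} {w : V} :
    (code G x n w).testBit i = true ↔ i < n ∧ G.Adj w (x i) := by
  rcases Nat.lt_or_ge i n with h | h
  · simp [code, Nat.testBit_ofBits_lt _ _ h, h]
  · simp [code, Nat.testBit_ofBits_ge _ _ h, h]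

lemma testBit_row {n i j : ℕ} :
    (vert G x n i).row.testBit j = true ↔ j < n ∧ G.Adj (x i) (x j) :=
  testBit_code

lemma testBit_tab {n i N : ℕ} :
    (vert G x n i).tab.testBit N = true ↔ N < 2 ^ n ∧ N.testBit i = true := by
  rcases Nat.lt_or_ge N (2 ^ n) with h | h
  · simp [vert, Nat.testBit_ofBits_lt _ _ h, h]
  · simp [vert, Nat.testBit_ofBits_ge _ _ h, h]

lemma testBit_tab_code {n i : ℕ} {w : V} :
    (vert G x n i).tab.testBit (code G x n w) = true ↔ i < n ∧ G.Adj w (x i) := by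
  rw [testBit_tab, testBit_code]
  exact and_iff_right (code_lt n w)

lemma testBit_tab_code_eq {n i : ℕ} {w : V} (hi : i < n) [Decidable (G.Adj w (x i))] :
    (vert G x n i).tab.testBit (code G x n w) = decide (G.Adj w (x i)) := by
  rw [Bool.eq_iff_iff, testBit_tab_code]
  simp [hi]

lemma testBit_row_eq {n i j : ℕ} (hj : j < n) [Decidable (G.Adj (x i) (x j))] :
    (vert G x n i).row.testBit j = decide (G.Adj (x i) (x j)) := by
  rw [Bool.eq_iff_iff, testBit_row]
  simp [hj]

lemma testBit_gather_verts {n k S N : ℕ} {f : Vtx → ℕ}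
    (h : (gather S f (verts G x n k)).testBit N = true) :
    ∃ i < k, S.testBit i = true ∧ (f (vert G x n i)).testBit N = true := by
  obtain ⟨v, hv, h1, h2⟩ := testBit_gather h
  obtain ⟨i, hi, rfl⟩ := mem_verts.mp hv
  refine ⟨i, hi, ?_, h2⟩
  rw [Ne, show (vert G x n i).bit = 2 ^ i from rfl, land_two_pow_eq_zero_iff] at h1
  simpa using h1

/-- There is no induced path on five vertices. -/
def NoPathFive (G : SimpleGraph V) : Prop :=
  ∀ a b c d e, G.Adj a b → G.Adj b c → G.Adj c d → G.Adj d e → ¬ G.Adj a c → ¬ G.Adj a d →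
    ¬ G.Adj a e → ¬ G.Adj b d → ¬ G.Adj b e → ¬ G.Adj c e → False

/-- There are no four pairwise adjacent vertices. -/
def NoCliqueFour (G : SimpleGraph V) : Prop :=
  ∀ a b c d, G.Adj a b → G.Adj a c → G.Adj a d → G.Adj b c → G.Adj b d → G.Adj c d → False

lemma not_testBit_pathTypes (hP : NoPathFive G) {k p q r : ℕ} (hp : p ≤ k) (hq : q ≤ k)
    (hr : r ≤ k) (hpq : G.Adj (x p) (x q)) (hqr : G.Adj (x q) (x r)) (hpr : ¬ G.Adj (x p) (x r))
    (w : V) :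
    (pathTypes (Nat.sub (2 ^ k) 1) (verts G x (k + 1) k) (vert G x (k + 1) p) (vert G x (k + 1) q)
      (vert G x (k + 1) r)).testBit (code G x (k + 1) w) = false := by
  classical
  rw [← Bool.not_eq_true]
  intro h
  have hp' := Nat.lt_succ_of_le hp
  have hq' := Nat.lt_succ_of_le hq
  have hr' := Nat.lt_succ_of_le hr
  rw [pathTypes, testBit_lor, Bool.or_eq_true, testBit_land, Bool.and_eq_true] at h
  rcases h with h | ⟨h, h'⟩
  · obtain ⟨d, hd, h1, h2⟩ := testBit_gather_verts h
    have hd' : d < k + 1 := by omega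
    simp [testBit_diff, testBit_row_eq, testBit_tab_code_eq, hp', hq', hr', hd'] at h1 h2
    obtain ⟨h1, h3, h4⟩ := h1
    rcases h2 with ⟨h5, h6, h7, h8⟩ | ⟨h5, h6, h7, h8⟩
    · exact hP _ _ _ _ _ h5 hpq hqr h1 h6 h7 h8 hpr h3 h4
    · exact hP _ _ _ _ _ hpq hqr h1 h5.symm hpr h3 (fun h => h6 h.symm) h4 (fun h => h7 h.symm)
        (fun h => h8 h.symm)
  · obtain ⟨d, hd, h1, h2⟩ := testBit_gather_verts h'
    have hd' : d < k + 1 := by omega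
    simp [testBit_diff, testBit_row_eq, testBit_tab_code_eq, hp', hq', hr', hd', hd] at h h1 h2
    obtain ⟨h1, h3, h4⟩ := h1
    obtain ⟨h, h5⟩ := h
    by_cases hwp : G.Adj w (x p)
    · have hwr : ¬ G.Adj w (x r) := by tauto
      exact hP _ _ _ _ _ h2.symm hwp hpq hqr (fun h => h1 h.symm) (fun h => h3 h.symm)
        (fun h => h4 h.symm) h5 hwr hpr
    · have hwr : G.Adj w (x r) := by tauto
      exact hP _ _ _ _ _ h2.symm hwr hqr.symm hpq.symm (fun h => h4 h.symm) (fun h => h3 h.symm)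
        (fun h => h1 h.symm) h5 hwp (fun h => hpr h.symm)

lemma not_testBit_forbidden (hP : NoPathFive G) (hK : NoCliqueFour G) (k : ℕ) (w : V) :
    (forbidden (verts G x (k + 1) k) (vert G x (k + 1) k)).testBit (code G x (k + 1) w) =
      false := by
  classical
  rw [← Bool.not_eq_true]
  intro h
  have hk := Nat.lt_succ_self k
  simp only [forbidden] at h
  rw [show (vert G x (k + 1) k).bit = 2 ^ k from rfl] at h
  simp only [testBit_lor, testBit_land, Bool.or_eq_true, Bool.and_eq_true] at h
  rcases h with h | ⟨h, h'⟩
  · obtain ⟨b, hb, h1, h2⟩ := testBit_gather_verts h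
    have hb' : b < k + 1 := by omega
    have hkb := (testBit_row.mp h1).2
    simp only [testBit_lor, testBit_land, Bool.or_eq_true, Bool.and_eq_true] at h2
    rcases h2 with ⟨⟨h2, h3⟩, h4⟩ | h2 | h2 | ⟨h2, h3⟩
    · obtain ⟨c, hc, h5, h6⟩ := testBit_gather_verts h4
      rw [testBit_land, Bool.and_eq_true, testBit_row, testBit_row] at h5
      rw [testBit_tab_code] at h2 h3 h6
      exact hK _ _ _ _ h2.2 h3.2 h6.2 hkb h5.1.2 h5.2.2
    · obtain ⟨c, hc, h5, h6⟩ := testBit_gather_verts h2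
      have hc' : c < k + 1 := by omega
      simp [testBit_diff, testBit_row_eq, hc'] at h5
      rw [not_testBit_pathTypes hP le_rfl hb.le hc.le hkb h5.1 h5.2] at h6
      exact Bool.noConfusion h6
    · obtain ⟨c, hc, h5, h6⟩ := testBit_gather_verts h2
      have hc' : c < k + 1 := by omega
      simp [testBit_diff, testBit_row_eq, hc'] at h5
      rw [not_testBit_pathTypes hP hb.le le_rfl hc.le hkb.symm h5.1 h5.2] at h6
      exact Bool.noConfusion h6
    · obtain ⟨c, hc, h5, h6⟩ := testBit_gather_verts h3
      obtain ⟨d, hd, h7, h8⟩ := testBit_gather_verts h6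
      have hc' : c < k + 1 := by omega
      have hd' : d < k + 1 := by omega
      simp [testBit_diff, testBit_row_eq, testBit_tab_code_eq, hc', hd', hb', hc, hd] at h2 h5 h7 h8
      obtain ⟨h5, h9⟩ := h5
      obtain ⟨⟨h10, h11⟩, h12⟩ := h7
      obtain ⟨h13, h14⟩ := h8
      by_cases hwk : G.Adj w (x k)
      · have hwb : ¬ G.Adj w (x b) := by tauto
        exact hP _ _ _ _ _ hkb.symm hwk.symm h13 h12 (fun h => hwb h.symm) h9 h11 h5 h10 h14
      · have hwb : G.Adj w (x b) := by tauto
        exact hP _ _ _ _ _ hkb hwb.symm h13 h12 (fun h => hwk h.symm) h5 h10 h9 h11 h14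
  · obtain ⟨b, hb, h1, h2⟩ := testBit_gather_verts h'
    obtain ⟨c, hc, h3, h4⟩ := testBit_gather_verts h2
    obtain ⟨d, hd, h5, h6⟩ := testBit_gather_verts h4
    have hb' : b < k + 1 := by omega
    have hc' : c < k + 1 := by omega
    have hd' : d < k + 1 := by omega
    simp [testBit_diff, testBit_row_eq, testBit_tab_code_eq, hb', hc', hd', hb] at h h1 h3 h5 h6
    exact hP _ _ _ _ _ h.symm h6.1 h3.1 h5.1 h1 h3.2 h5.2.1 h6.2.1 h6.2.2 h5.2.2

lemma colorable_cons (v : Vtx) (L : List Vtx) (a b c : ℕ) :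
    colorable (v :: L) a b c =
      ((Nat.beq (Nat.land v.row a) 0 && colorable L (Nat.lor a v.bit) b c) ||
      ((Nat.beq (Nat.land v.row b) 0 && colorable L a (Nat.lor b v.bit) c) ||
        (Nat.beq (Nat.land v.row c) 0 && colorable L a b (Nat.lor c v.bit)))) := by
  change cond' (cond' _ (colorable L _ _ _) _) _ (cond' (cond' _ (colorable L _ _ _) _) _
    (cond' _ (colorable L _ _ _) _)) = _
  simp only [cond'_eq]
  cases Nat.beq (Nat.land v.row a) 0 <;> cases Nat.beq (Nat.land v.row b) 0 <;>
    cases Nat.beq (Nat.land v.row c) 0 <;> simp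

/-- A labelling by residues modulo three extends any partial labelling by its own values. -/
lemma colorable_of_colOn {n : ℕ} {f : V → ZMod 3} (hf : ColOn G {y | ∃ i < n, x i = y} f)
    {L : List Vtx} (hL : ∀ v ∈ L, ∃ i < n, v = vert G x n i) :
    ∀ {a b c : ℕ} {α β γ : ZMod 3}, (∀ y, y = α ∨ y = β ∨ y = γ) →
      (∀ j, a.testBit j = true → f (x j) = α) → (∀ j, b.testBit j = true → f (x j) = β) →
      (∀ j, c.testBit j = true → f (x j) = γ) → colorable L a b c = true := by
  induction L with
  | nil => intros; rfl
  | cons v L ih =>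
    intro a b c α β γ hcov ha hb hc
    obtain ⟨i, hi, rfl⟩ := hL v List.mem_cons_self
    have ih' := @ih (fun v hv => hL v (List.mem_cons_of_mem _ hv))
    have hrow : ∀ (s : ℕ) (δ : ZMod 3), (∀ j, s.testBit j = true → f (x j) = δ) → f (x i) = δ →
        Nat.beq (Nat.land (vert G x n i).row s) 0 = true := by
      intro s δ hs hiδ
      rw [Nat.beq_eq]
      by_contra hne
      obtain ⟨j, hj⟩ := Nat.exists_testBit_of_ne_zero hne
      rw [testBit_land, Bool.and_eq_true, testBit_row] at hj
      have h1 := hf (⟨i, hi, rfl⟩ : x i ∈ {y | ∃ i < n, x i = y}) ⟨j, hj.1.1, rfl⟩ hj.1.2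
      rw [hs j hj.2, hiδ] at h1
      rcases h1 with h1 | h1 <;> exact absurd h1 (by simp)
    have hadd : ∀ (s : ℕ) (δ : ZMod 3), (∀ j, s.testBit j = true → f (x j) = δ) → f (x i) = δ →
        ∀ j, (Nat.lor s (vert G x n i).bit).testBit j = true → f (x j) = δ := by
      intro s δ hs hiδ j hj
      rw [testBit_lor, Bool.or_eq_true, show (vert G x n i).bit = 2 ^ i from rfl,
        Nat.testBit_two_pow, decide_eq_true_iff] at hj
      rcases hj with hj | rfl
      · exact hs j hj
      · exact hiδ
    rw [colorable_cons, Bool.or_eq_true, Bool.or_eq_true, Bool.and_eq_true, Bool.and_eq_true,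
      Bool.and_eq_true]
    rcases hcov (f (x i)) with h | h | h
    · exact Or.inl ⟨hrow a α ha h, ih' hcov (hadd a α ha h) hb hc⟩
    · exact Or.inr (Or.inl ⟨hrow b β hb h, ih' hcov ha (hadd b β hb h) hc⟩)
    · exact Or.inr (Or.inr ⟨hrow c γ hc h, ih' hcov ha hb (hadd c γ hc h)⟩)

/-! ### Soundness of the search -/

lemma allBits_sound {p : ℕ → Bool} : ∀ {k T N : ℕ}, allBits p k T N = true → ∀ j < 2 ^ k,
    T.testBit j = true → p (N ||| j) = true := by
  intro k
  induction k with
  | zero =>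
    intro T N h j hj hT
    obtain rfl : j = 0 := by simpa using hj
    change cond' (Nat.beq T 0) true (p N) = true at h
    rw [cond'_eq] at h
    split_ifs at h with hT0
    · rw [Nat.beq_eq] at hT0
      simp [hT0] at hT
    · simpa using h
  | succ k ih =>
    intro T N h j hj hT
    change cond' (Nat.beq T 0) true (cond' (allBits p k _ N) (allBits p k _ _) false) = true at h
    rw [cond'_eq, cond'_eq] at h
    split_ifs at h with hT0 h1
    · rw [Nat.beq_eq] at hT0
      simp [hT0] at hT
    · rcases Nat.lt_or_ge j (2 ^ k) with hjk | hjk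
      · refine ih h1 j hjk ?_
        rw [testBit_land, Bool.and_eq_true]
        exact ⟨hT, (testBit_full (2 ^ k) j).trans (by simpa using hjk)⟩
      · have h2 := ih h (j - 2 ^ k) (by rw [pow_succ] at hj; omega) (by
          change (T >>> (2 ^ k)).testBit (j - 2 ^ k) = true
          rw [Nat.testBit_shiftRight, Nat.add_sub_cancel' hjk]
          exact hT)
        have h3 := Nat.two_pow_add_eq_or_of_lt (i := k) (b := j - 2 ^ k)
          (by rw [pow_succ] at hj; omega) 1
        rw [mul_one, Nat.add_sub_cancel' hjk] at h3
        change p ((N ||| 2 ^ k) ||| (j - 2 ^ k)) = true at h2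
        rwa [Nat.or_assoc, ← h3] at h2

lemma extend_eq (b N : ℕ) (A : List Vtx) (k : List Vtx → Bool) :
    extend b N A k = k (A.map fun v => ⟨v.bit,
      cond' (Nat.beq (Nat.land v.bit N) 0) v.row (Nat.lor v.row b),
      Nat.lor v.tab (Nat.shiftLeft v.tab b)⟩) := by
  induction A generalizing k with
  | nil => rfl
  | cons v A ih => exact ih _

lemma code_update {n m : ℕ} (hmn : m ≤ n) (w v : V) :
    code G (Function.update x n w) m v = code G x m v := by
  refine Nat.eq_of_testBit_eq fun i => ?_
  rw [Bool.eq_iff_iff, testBit_code, testBit_code]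
  refine and_congr_right fun hi => ?_
  rw [Function.update_of_ne (by omega)]

lemma testBit_code_succ {n i : ℕ} {v : V} : (code G x (n + 1) v).testBit i = true ↔
    (code G x n v).testBit i = true ∨ i = n ∧ G.Adj v (x n) := by
  rw [testBit_code, testBit_code, Nat.lt_succ_iff_lt_or_eq]
  constructor
  · rintro ⟨h | rfl, h'⟩
    · exact Or.inl ⟨h, h'⟩
    · exact Or.inr ⟨rfl, h'⟩
  · rintro (⟨h, h'⟩ | ⟨rfl, h'⟩)
    · exact ⟨Or.inl h, h'⟩
    · exact ⟨Or.inr rfl, h'⟩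

lemma code_succ_of_not_adj {n : ℕ} {v : V} (h : ¬ G.Adj v (x n)) :
    code G x (n + 1) v = code G x n v := by
  refine Nat.eq_of_testBit_eq fun i => ?_
  rw [Bool.eq_iff_iff, testBit_code_succ]
  tauto

lemma code_succ_of_adj {n : ℕ} {v : V} (h : G.Adj v (x n)) :
    code G x (n + 1) v = code G x n v ||| 2 ^ n := by
  refine Nat.eq_of_testBit_eq fun i => ?_
  rw [Bool.eq_iff_iff, testBit_code_succ, Nat.testBit_or, Bool.or_eq_true, Nat.testBit_two_pow,
    decide_eq_true_iff]
  rw [and_iff_left h, eq_comm (a := i) (b := n)]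

lemma vert_extend {n i : ℕ} (hi : i < n) (w : V) :
    (⟨(vert G x n i).bit, cond' (Nat.beq (Nat.land (vert G x n i).bit (code G x n w)) 0)
        (vert G x n i).row (Nat.lor (vert G x n i).row (2 ^ n)),
      Nat.lor (vert G x n i).tab (Nat.shiftLeft (vert G x n i).tab (2 ^ n))⟩ : Vtx) =
      vert G (Function.update x n w) (n + 1) i := by
  have hin : Function.update x n w i = x i := Function.update_of_ne (by omega) _ _
  have hnn : Function.update x n w n = w := Function.update_self _ _ _
  have hrow : cond' (Nat.beq (Nat.land (vert G x n i).bit (code G x n w)) 0)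
      (vert G x n i).row (Nat.lor (vert G x n i).row (2 ^ n)) =
      (vert G (Function.update x n w) (n + 1) i).row := by
    change cond' (Nat.beq (Nat.land (2 ^ i) (code G x n w)) 0) (code G x n (x i))
      (Nat.lor (code G x n (x i)) (2 ^ n)) =
      code G (Function.update x n w) (n + 1) (Function.update x n w i)
    have hadj : Nat.beq (Nat.land (2 ^ i) (code G x n w)) 0 = true ↔ ¬ G.Adj (x i) w := by
      rw [Nat.beq_eq, land_two_pow_eq_zero_iff, ← Bool.not_eq_true, testBit_code, G.adj_comm]
      tauto
    rw [cond'_eq, hin]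
    split_ifs with h
    · rw [code_succ_of_not_adj (by rw [hnn]; exact hadj.mp h), code_update le_rfl]
    · rw [code_succ_of_adj (by rw [hnn]; exact not_not.mp (fun h' => h (hadj.mpr h'))),
        code_update le_rfl]
      rfl
  have htab : Nat.lor (vert G x n i).tab (Nat.shiftLeft (vert G x n i).tab (2 ^ n)) =
      (vert G (Function.update x n w) (n + 1) i).tab := by
    refine Nat.eq_of_testBit_eq fun N => ?_
    rw [Bool.eq_iff_iff, testBit_lor, Bool.or_eq_true, testBit_tab, testBit_tab,
      show Nat.shiftLeft (vert G x n i).tab (2 ^ n) = (vert G x n i).tab <<< (2 ^ n) from rfl,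
      Nat.testBit_shiftLeft, Bool.and_eq_true, testBit_tab, decide_eq_true_iff, pow_succ]
    rcases Nat.lt_or_ge N (2 ^ n) with h | h
    · constructor
      · rintro (h1 | h1)
        · exact ⟨by omega, h1.2⟩
        · omega
      · exact fun h1 => Or.inl ⟨h, h1.2⟩
    · obtain ⟨M, rfl⟩ : ∃ M, N = 2 ^ n + M := ⟨N - 2 ^ n, by omega⟩
      rw [Nat.add_sub_cancel_left, Nat.testBit_two_pow_add_gt hi]
      constructor
      · rintro (h1 | h1)
        · omega
        · exact ⟨by omega, h1.2.2⟩
      · exact fun h1 => Or.inr ⟨h, by omega, h1.2⟩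
  rw [hrow, htab]
  rfl

lemma vert_last (n : ℕ) (w : V) :
    (⟨2 ^ n, code G x n w, Nat.shiftLeft (Nat.sub (Nat.pow 2 (2 ^ n)) 1) (2 ^ n)⟩ : Vtx) =
      vert G (Function.update x n w) (n + 1) n := by
  have hrow : code G x n w = (vert G (Function.update x n w) (n + 1) n).row := by
    change _ = code G (Function.update x n w) (n + 1) (Function.update x n w n)
    rw [Function.update_self, code_succ_of_not_adj (by simp), code_update le_rfl]
  have htab : Nat.shiftLeft (Nat.sub (Nat.pow 2 (2 ^ n)) 1) (2 ^ n) =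
      (vert G (Function.update x n w) (n + 1) n).tab := by
    refine Nat.eq_of_testBit_eq fun N => ?_
    rw [Bool.eq_iff_iff, testBit_tab,
      show Nat.shiftLeft (Nat.sub (Nat.pow 2 (2 ^ n)) 1) (2 ^ n) = (2 ^ 2 ^ n - 1) <<< (2 ^ n)
        from rfl,
      Nat.testBit_shiftLeft, Bool.and_eq_true, Nat.testBit_two_pow_sub_one, decide_eq_true_iff,
      decide_eq_true_iff, pow_succ]
    rcases Nat.lt_or_ge N (2 ^ n) with h | h
    · rw [Nat.testBit_lt_two_pow h]
      constructor
      · intro h1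
        omega
      · intro h1
        simp at h1
    · obtain ⟨M, rfl⟩ : ∃ M, N = 2 ^ n + M := ⟨N - 2 ^ n, by omega⟩
      rw [Nat.testBit_two_pow_add_eq]
      constructor
      · intro h1
        refine ⟨by omega, ?_⟩
        rw [Nat.testBit_lt_two_pow (by omega)]
        rfl
      · intro h1
        omega
  rw [hrow, htab]
  rfl

lemma verts_succ (n k : ℕ) : verts G x n (k + 1) = verts G x n k ++ [vert G x n k] := by
  simp [verts, List.range_succ]

/-- Unless it is empty, the set `t` of types contains the type of a vertex outside
`x 0, …, x (n - 1)`. -/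
def Hits (G : SimpleGraph V) (x : ℕ → V) (n t : ℕ) : Prop :=
  t ≠ 0 → ∃ w, (∀ i < n, x i ≠ w) ∧ t.testBit (code G x n w) = true

namespace Hits

variable {n : ℕ}

lemma zero : Hits G x n 0 := fun h => absurd rfl h

lemma cond {c : Bool} {a b : ℕ} (ha : c = true → Hits G x n a) (hb : c = false → Hits G x n b) :
    Hits G x n (cond' c a b) := by
  cases c
  · exact hb rfl
  · exact ha rfl

lemma orElse {a b : ℕ} (ha : Hits G x n a) (hb : Hits G x n b) :
    Hits G x n (Search.orElse a b) :=
  cond (fun _ => hb) fun _ => ha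

lemma first {f : Vtx → ℕ} {L : List Vtx} (h : ∀ v ∈ L, Hits G x n (f v)) :
    Hits G x n (Search.first f L) := by
  induction L with
  | nil => exact zero
  | cons v L ih =>
    exact orElse (h v List.mem_cons_self) (ih fun u hu => h u (List.mem_cons_of_mem _ hu))

lemma first_verts {f : Vtx → ℕ} (h : ∀ i < n, Hits G x n (f (vert G x n i))) :
    Hits G x n (Search.first f (verts G x n n)) :=
  first fun v hv => by
    obtain ⟨i, hi, rfl⟩ := mem_verts.mp hv
    exact h i hi

lemma firstIn {f : Vtx → ℕ} {S : ℕ}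
    (h : ∀ i < n, S.testBit i = true → Hits G x n (f (vert G x n i))) :
    Hits G x n (Search.firstIn S f (verts G x n n)) :=
  first_verts fun i hi => cond (fun _ => zero) fun hS => h i hi (by
    rw [← Bool.not_eq_true, Nat.beq_eq, show (vert G x n i).bit = 2 ^ i from rfl,
      land_two_pow_eq_zero_iff] at hS
    simpa using hS)

lemma ifSub {a b t : ℕ} (h : (∀ i, a.testBit i = true → b.testBit i = true) → Hits G x n t) :
    Hits G x n (Search.ifSub a b t) :=
  cond (fun hab => h (land_eq_left_iff.mp (by rwa [Nat.beq_eq] at hab))) fun _ => zero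

end Hits

section rules

variable {n : ℕ} (hG : Critical G 5) (hx : ∀ i < n, ∀ j < n, x i = x j → i = j)
include hG

/-- Every vertex has at least three neighbours. -/
lemma exists_third (v p q : V) : ∃ t, G.Adj v t ∧ t ≠ p ∧ t ≠ q := by
  classical
  by_contra hcon
  push Not at hcon
  obtain ⟨f, hf⟩ := hG.sub_col {v}ᶜ (by simp [Set.compl_eq_univ_sdiff])
  obtain ⟨γ, hγ⟩ : ∃ γ : ZMod 3, γ ≠ f p ∧ γ ≠ f q := by
    generalize f p = α
    generalize f q = β
    revert α β
    decide
  have hne : ∀ α β : ZMod 3, α ≠ β → β = α + 1 ∨ α = β + 1 := by decide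
  have hγ' : ∀ t, G.Adj v t → γ ≠ f t := by
    intro t ht
    by_cases h : t = p
    · rw [h]
      exact hγ.1
    · rw [hcon t ht h]
      exact hγ.2
  refine hG.not_col ⟨Function.update f v γ, fun y _ z _ hyz => ?_⟩
  by_cases hy : y = v
  · subst hy
    rw [Function.update_self, Function.update_of_ne hyz.ne']
    exact hne _ _ (hγ' z hyz)
  · rw [Function.update_of_ne hy]
    by_cases hz : z = v
    · subst hz
      rw [Function.update_self]
      exact hne _ _ (hγ' y hyz.symm).symm
    · rw [Function.update_of_ne hz]
      exact hf hy hz hyz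

lemma hits_degreeRule : Hits G x n (degreeRule (verts G x n n)) := by
  refine Hits.first_verts fun i hi => Hits.firstIn fun a ha _ => Hits.firstIn fun b hb _ =>
    Hits.ifSub fun hsub _ => ?_
  obtain ⟨w, h1, h2, h3⟩ := exists_third hG (x i) (x a) (x b)
  refine ⟨w, ?_, testBit_tab_code.mpr ⟨hi, h1.symm⟩⟩
  rintro l hl rfl
  have := hsub l (testBit_row.mpr ⟨hl, h1⟩)
  rw [testBit_lor, Bool.or_eq_true, show (vert G x n a).bit = 2 ^ a from rfl,
    show (vert G x n b).bit = 2 ^ b from rfl, Nat.testBit_two_pow, Nat.testBit_two_pow,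
    decide_eq_true_iff, decide_eq_true_iff] at this
  rcases this with rfl | rfl
  · exact h2 rfl
  · exact h3 rfl

include hx

lemma hits_vertexRule : Hits G x n (vertexRule (verts G x n n)) := by
  refine Hits.first fun v hv => ?_
  obtain ⟨i, hi, rfl⟩ := mem_verts.mp (List.mem_reverse.mp hv)
  refine Hits.first_verts fun j hj => Hits.ifSub fun hsub => ?_
  rcases eq_or_ne i j with rfl | hij
  · have : diff (vert G x n i).tab (vert G x n i).tab = 0 :=
      Nat.eq_of_testBit_eq fun N => by rw [testBit_diff]; simp
    rw [this]
    exact Hits.zero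
  intro _
  obtain ⟨w, h1, h2⟩ := hG.exists_adj_not_adj (fun h => hij (hx i hi j hj h))
  refine ⟨w, ?_, ?_⟩
  · rintro l hl rfl
    exact h2 (testBit_row.mp (hsub l (testBit_row.mpr ⟨hl, h1⟩))).2
  · rw [testBit_diff, Bool.and_eq_true, testBit_tab_code, Bool.not_eq_true', ← Bool.not_eq_true,
      testBit_tab_code]
    exact ⟨⟨hi, h1.symm⟩, fun h => h2 h.2.symm⟩

lemma hits_triangleRule : Hits G x n (triangleRule (Nat.sub (2 ^ n) 1) (verts G x n n)) := by
  classical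
  refine Hits.first_verts fun a ha => Hits.firstIn fun b hb hab => Hits.firstIn fun c hc hac =>
    Hits.firstIn fun p hp hp' => Hits.ifSub fun hap => Hits.firstIn fun q hq hq' =>
    Hits.ifSub fun hbq => Hits.firstIn fun r hr hr' => Hits.ifSub fun hcr _ => ?_
  have hbit : ∀ i j, (vert G x n i).bit.testBit j = decide (i = j) := fun i j =>
    Nat.testBit_two_pow
  simp only [testBit_land, testBit_lor, testBit_diff, hbit, Bool.and_eq_true, Bool.or_eq_true,
    Bool.not_eq_true', Bool.or_eq_false_iff, decide_eq_true_iff, decide_eq_false_iff_not,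
    testBit_row] at hab hac hp' hap hq' hbq hr' hcr
  have hne : ∀ i < n, ∀ j < n, i ≠ j → x j ≠ x i := fun i hi j hj hij h => hij (hx j hj i hi h).symm
  have hba : x b ≠ x a := hab.1.2.ne'
  have hca : x c ≠ x a := hac.1.1.2.ne'
  have hcb : x c ≠ x b := hac.1.2.2.ne'
  let φ : V → V := fun v => if v = x a then x p else if v = x b then x q else x r
  have φa : φ (x a) = x p := if_pos rfl
  have φb : φ (x b) = x q := by simp only [φ, if_neg hba, if_true]
  have φc : φ (x c) = x r := by simp only [φ, if_neg hca, if_neg hcb]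
  obtain ⟨s, hs, w, hw, h1, h2⟩ := hG.exists_not_adj_of_fold (S := {x a, x b, x c}) ⟨x a, by simp⟩ φ
    (by
      rintro s (rfl | rfl | rfl)
      · rw [φa]
        simp [hne _ ha _ hp hp'.2.1, hne _ hb _ hp hp'.2.2.1, hne _ hc _ hp hp'.2.2.2]
      · rw [φb]
        simp [hne _ ha _ hq hq'.2.1, hne _ hb _ hq hq'.2.2.1, hne _ hc _ hq hq'.2.2.2]
      · rw [φc]
        simp [hne _ ha _ hr hr'.2.1, hne _ hb _ hr hr'.2.2.1, hne _ hc _ hr hr'.2.2.2])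
    (by
      rintro s (rfl | rfl | rfl) t (rfl | rfl | rfl) hst <;>
        first
        | exact absurd rfl hst.ne
        | simp only [φa, φb, φc]
          first
          | exact hq'.1.2
          | exact hq'.1.2.symm
          | exact hr'.1.1.2
          | exact hr'.1.1.2.symm
          | exact hr'.1.2.2
          | exact hr'.1.2.2.symm)
  simp only [Set.mem_insert_iff, Set.mem_singleton_iff, not_or] at hs hw
  refine ⟨w, ?_, ?_⟩
  · rintro l hl rfl
    rcases hs with rfl | rfl | rfl
    · rw [φa] at h2
      rcases hap l ⟨hl, h1⟩ with (rfl | rfl) | h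
      · exact hw.2.1 rfl
      · exact hw.2.2 rfl
      · exact h2 h.2
    · rw [φb] at h2
      rcases hbq l ⟨hl, h1⟩ with (rfl | rfl) | h
      · exact hw.1 rfl
      · exact hw.2.2 rfl
      · exact h2 h.2
    · rw [φc] at h2
      rcases hcr l ⟨hl, h1⟩ with (rfl | rfl) | h
      · exact hw.1 rfl
      · exact hw.2.1 rfl
      · exact h2 h.2
  · simp only [testBit_lor, testBit_diff, Bool.or_eq_true, Bool.and_eq_true, Bool.not_eq_true',
      ← Bool.not_eq_true, testBit_tab_code]
    rcases hs with rfl | rfl | rfl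
    · exact Or.inl ⟨⟨ha, h1.symm⟩, fun h => h2 (φa ▸ h.2.symm)⟩
    · exact Or.inr (Or.inl ⟨⟨hb, h1.symm⟩, fun h => h2 (φb ▸ h.2.symm)⟩)
    · exact Or.inr (Or.inr ⟨⟨hc, h1.symm⟩, fun h => h2 (φc ▸ h.2.symm)⟩)

lemma hits_required : Hits G x n (required (Nat.sub (2 ^ n) 1) (verts G x n n)) :=
  (hits_vertexRule hG hx).orElse ((hits_degreeRule hG).orElse (hits_triangleRule hG hx))

end rules

lemma length_verts (x : ℕ → V) (n k : ℕ) : (verts G x n k).length = k := by simp [verts]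

lemma map_extend (x : ℕ → V) (n : ℕ) (w : V) :
    ((verts G x n n).map fun v => (⟨v.bit,
      cond' (Nat.beq (Nat.land v.bit (code G x n w)) 0) v.row (Nat.lor v.row (2 ^ n)),
      Nat.lor v.tab (Nat.shiftLeft v.tab (2 ^ n))⟩ : Vtx)) =
      verts G (Function.update x n w) (n + 1) n := by
  rw [verts, verts, List.map_map]
  exact List.map_congr_left fun i hi => vert_extend (List.mem_range.mp hi) w

/-- The types that remain possible after the vertex `x k` has been taken into account. -/
lemma testBit_types (hP : NoPathFive G) (hK : NoCliqueFour G) {x : ℕ → V} {k M : ℕ} {w : V}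
    (hM : M.testBit (code G x k w) = true) :
    (diff (Nat.lor M (Nat.shiftLeft M (2 ^ k)))
      (forbidden (verts G x (k + 1) k) (vert G x (k + 1) k))).testBit (code G x (k + 1) w) =
      true := by
  rw [testBit_diff, not_testBit_forbidden hP hK, testBit_lor, Bool.not_false, Bool.and_true,
    Bool.or_eq_true]
  by_cases h : G.Adj w (x k)
  · right
    have h1 := Nat.two_pow_add_eq_or_of_lt (code_lt (G := G) (x := x) k w) 1
    rw [mul_one] at h1
    rw [code_succ_of_adj h, Nat.or_comm, ← h1]
    change (M <<< (2 ^ k)).testBit _ = true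
    rw [Nat.testBit_shiftLeft, Nat.add_sub_cancel_left, hM]
    simp
  · left
    rwa [code_succ_of_not_adj h]

lemma card_le_of_not_colOn (hG : Critical G 5) {x : ℕ → V} {n : ℕ}
    (h : ¬ ∃ f : V → ZMod 3, ColOn G {y | ∃ i < n, x i = y} f) : Nat.card V ≤ n := by
  have h1 : x '' (Set.Iio n) = Set.univ := hG.eq_univ h
  rw [← Set.ncard_univ, ← h1]
  refine (Set.ncard_image_le (Set.finite_Iio n)).trans ?_
  simp [Set.ncard_eq_toFinset_card']

/-- Invariant of the search: the encoding describes vertices `x 0, …, x k` of the obstruction, and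
the types of all other vertices belong to `M`. -/
lemma search_sound (hG : Critical G 5) (hP : NoPathFive G) (hK : NoCliqueFour G) {fuel : ℕ} :
    ∀ {k M : ℕ} {x : ℕ → V}, (∀ i < k + 1, ∀ j < k + 1, x i = x j → i = j) → 2 ≤ k →
      G.Adj (x 0) (x 1) → G.Adj (x 0) (x 2) → G.Adj (x 1) (x 2) →
      (∀ w, (∀ i < k + 1, x i ≠ w) → M.testBit (code G x k w) = true) →
      search fuel (verts G x (k + 1) k) (vert G x (k + 1) k) M = true →
      Nat.card V ≤ k + 1 + fuel := by
  induction fuel with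
  | zero =>
    intro k M x _ _ _ _ _ _ h
    exact Bool.noConfusion h
  | succ fuel ih =>
    intro k M x hx hk h01 h02 h12 hM h
    by_cases hcol : ∃ f : V → ZMod 3, ColOn G {y | ∃ i < k + 1, x i = y} f
    swap
    · have := card_le_of_not_colOn hG hcol
      omega
    obtain ⟨f, hf⟩ := hcol
    set M' := diff (Nat.lor M (Nat.shiftLeft M (2 ^ k)))
      (forbidden (verts G x (k + 1) k) (vert G x (k + 1) k)) with hM'
    have hb : Nat.mul 2 (2 ^ k) = 2 ^ (k + 1) := by
      rw [pow_succ, mul_comm]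
      rfl
    have hlen : Nat.succ (verts G x (k + 1) k).length = k + 1 := by rw [length_verts]
    change cond' (colorable (List.tail (List.tail (List.tail
        (verts G x (k + 1) k ++ [vert G x (k + 1) k])))) 1 2 4)
      (cond' (Nat.beq (required (Nat.sub (Nat.mul 2 (2 ^ k)) 1)
          (verts G x (k + 1) k ++ [vert G x (k + 1) k])) 0) false
        (allBits (fun N => extend (Nat.mul 2 (2 ^ k)) N
            (verts G x (k + 1) k ++ [vert G x (k + 1) k]) fun A' =>
            search fuel A' ⟨Nat.mul 2 (2 ^ k), N, Nat.shiftLeft (Nat.sub (Nat.pow 2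
              (Nat.mul 2 (2 ^ k))) 1) (Nat.mul 2 (2 ^ k))⟩ M')
          (Nat.succ (verts G x (k + 1) k).length)
          (Nat.land M' (required (Nat.sub (Nat.mul 2 (2 ^ k)) 1)
            (verts G x (k + 1) k ++ [vert G x (k + 1) k]))) 0)) true = true at h
    rw [← verts_succ, hb, hlen] at h
    have hpow : ∀ s j : ℕ, (2 ^ s).testBit j = true → j = s := by
      intro s j hj
      rw [Nat.testBit_two_pow, decide_eq_true_iff] at hj
      exact hj.symm
    have hcov : ∀ y, y = f (x 0) ∨ y = f (x 1) ∨ y = f (x 2) := by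
      have h1 := hf ⟨0, by omega, rfl⟩ ⟨1, by omega, rfl⟩ h01
      have h2 := hf ⟨0, by omega, rfl⟩ ⟨2, by omega, rfl⟩ h02
      have h3 := hf ⟨1, by omega, rfl⟩ ⟨2, by omega, rfl⟩ h12
      generalize f (x 0) = α at *
      generalize f (x 1) = β at *
      generalize f (x 2) = γ at *
      clear * - h1 h2 h3
      revert α β γ
      decide
    rw [colorable_of_colOn hf (fun v hv => mem_verts.mp
        (List.mem_of_mem_tail (List.mem_of_mem_tail (List.mem_of_mem_tail hv)))) hcov
        (fun j hj => by rw [hpow 0 j hj]) (fun j hj => by rw [hpow 1 j hj])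
        (fun j hj => by rw [hpow 2 j hj]), cond'_eq, cond'_eq, if_pos rfl] at h
    split_ifs at h with hR
    rw [Nat.beq_eq] at hR
    obtain ⟨w, hw, hwR⟩ := hits_required hG hx hR
    have hMw : M'.testBit (code G x (k + 1) w) = true := testBit_types hP hK (hM w hw)
    have hnext := allBits_sound h (code G x (k + 1) w) (code_lt _ _)
      (by rw [testBit_land, hMw, hwR]; rfl)
    rw [Nat.zero_or, extend_eq, map_extend, vert_last] at hnext
    have hup : ∀ i < k + 1, Function.update x (k + 1) w i = x i := fun i hi =>
      Function.update_of_ne (by omega) _ _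
    have hself : Function.update x (k + 1) w (k + 1) = w := Function.update_self _ _ _
    have := ih ?_ (by omega) ?_ ?_ ?_ ?_ hnext
    · omega
    · intro i hi j hj hij
      rcases Nat.lt_succ_iff_lt_or_eq.mp hi with hi | rfl <;>
        rcases Nat.lt_succ_iff_lt_or_eq.mp hj with hj | rfl
      · rw [hup i hi, hup j hj] at hij
        exact hx i hi j hj hij
      · rw [hup i hi, hself] at hij
        exact absurd hij (hw i hi)
      · rw [hup j hj, hself] at hij
        exact absurd hij.symm (hw j hj)
      · rfl
    · rwa [hup 0 (by omega), hup 1 (by omega)]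
    · rwa [hup 0 (by omega), hup 2 (by omega)]
    · rwa [hup 1 (by omega), hup 2 (by omega)]
    · intro v hv
      have hv' : ∀ i < k + 1, x i ≠ v := fun i hi => by
        rw [← hup i hi]
        exact hv i (by omega)
      rw [code_update le_rfl]
      exact testBit_types hP hK (hM v hv')

open Classical in
lemma code_three (x : ℕ → V) (w : V) : code G x 3 w = (if G.Adj w (x 0) then 1 else 0) +
    (if G.Adj w (x 1) then 2 else 0) + (if G.Adj w (x 2) then 4 else 0) := by
  by_cases h0 : G.Adj w (x 0) <;> by_cases h1 : G.Adj w (x 1) <;> by_cases h2 : G.Adj w (x 2) <;>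
    simp [code, Nat.ofBits, Fin.foldr_succ, h0, h1, h2]

open Classical in
lemma code_four (x : ℕ → V) (w : V) : code G x 4 w = (if G.Adj w (x 0) then 1 else 0) +
    (if G.Adj w (x 1) then 2 else 0) + (if G.Adj w (x 2) then 4 else 0) +
    (if G.Adj w (x 3) then 8 else 0) := by
  by_cases h0 : G.Adj w (x 0) <;> by_cases h1 : G.Adj w (x 1) <;> by_cases h2 : G.Adj w (x 2) <;>
    by_cases h3 : G.Adj w (x 3) <;> simp [code, Nat.ofBits, Fin.foldr_succ, h0, h1, h2, h3]

/-- The enumeration that begins with four given vertices and then repeats the last one. -/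
def four (a b c d : V) (i : ℕ) : V :=
  if i = 0 then a else if i = 1 then b else if i = 2 then c else d

lemma verts_four {a b c d : V} (hab : G.Adj a b) (hac : G.Adj a c) (hbc : G.Adj b c)
    (had : G.Adj a d) (hcd : ¬ G.Adj c d) (r s : ℕ)
    (h : G.Adj b d ∧ r = 13 ∧ s = 3 ∨ ¬ G.Adj b d ∧ r = 5 ∧ s = 1) :
    verts G (four a b c d) 4 3 = [⟨1, 14, 0xAAAA⟩, ⟨2, r, 0xCCCC⟩, ⟨4, 3, 0xF0F0⟩] ∧
      vert G (four a b c d) 4 3 = ⟨8, s, 0xFF00⟩ := by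
  have hdc : ¬ G.Adj d c := fun h => hcd h.symm
  have h0 : four a b c d 0 = a := rfl
  have h1 : four a b c d 1 = b := rfl
  have h2 : four a b c d 2 = c := rfl
  have h3 : four a b c d 3 = d := rfl
  rcases h with ⟨hbd, rfl, rfl⟩ | ⟨hbd, rfl, rfl⟩
  · simp [verts, vert, List.range_succ, code_four, h0, h1, h2, h3, hab, hac, hbc,
      had, hcd, hbd, hab.symm, hac.symm, hbc.symm, had.symm, hdc, hbd.symm]
    decide
  · have hdb : ¬ G.Adj d b := fun h => hbd h.symm
    simp [verts, vert, List.range_succ, code_four, h0, h1, h2, h3, hab, hac, hbc,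
      had, hcd, hbd, hab.symm, hac.symm, hbc.symm, had.symm, hdc, hdb]
    decide

end Search

open Search in
/-- The case of obstructions to three-colourability: a `K₄` is an obstruction, and a search that
begins with two triangles sharing an edge or, if there are none, with a triangle and a further
vertex, finds all others. -/
theorem card_le_of_triangle {V : Type u} {G : SimpleGraph V} (hG : Critical G 5) {a b c : V}
    (hab : G.Adj a b) (hac : G.Adj a c) (hbc : G.Adj b c) : Nat.card V ≤ 14 := by
  classical
  have hP : NoPathFive G := by
    intro a b c d e h1 h2 h3 h4 h5 h6 h7 h8 h9 h10
    have := IndPath.length_lt (by omega) hG.free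
      (show IndPath G [a, b, c, d, e] from ⟨h1, by simp [h5, h6, h7], h2, by simp [h8, h9], h3,
        by simp [h10], h4, by simp, trivial⟩)
    simp at this
  by_cases hK : NoCliqueFour G
  swap
  · unfold NoCliqueFour at hK
    push Not at hK
    obtain ⟨a, b, c, d, h1, h2, h3, h4, h5, h6, -⟩ := hK
    have := card_le_of_not_colOn hG (x := four a b c d) (n := 4) (by
      rintro ⟨f, hf⟩
      have e1 := hf ⟨0, by omega, rfl⟩ ⟨1, by omega, rfl⟩ h1
      have e2 := hf ⟨0, by omega, rfl⟩ ⟨2, by omega, rfl⟩ h2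
      have e3 := hf ⟨0, by omega, rfl⟩ ⟨3, by omega, rfl⟩ h3
      have e4 := hf ⟨1, by omega, rfl⟩ ⟨2, by omega, rfl⟩ h4
      have e5 := hf ⟨1, by omega, rfl⟩ ⟨3, by omega, rfl⟩ h5
      have e6 := hf ⟨2, by omega, rfl⟩ ⟨3, by omega, rfl⟩ h6
      generalize f (four a b c d 0) = α at *
      generalize f (four a b c d 1) = β at *
      generalize f (four a b c d 2) = γ at *
      generalize f (four a b c d 3) = δ at *
      clear * - e1 e2 e3 e4 e5 e6
      revert α β γ δ
      decide)
    omega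
  have hinj : ∀ a b c d : V, a ≠ b → a ≠ c → a ≠ d → b ≠ c → b ≠ d → c ≠ d →
      ∀ i < 3 + 1, ∀ j < 3 + 1, four a b c d i = four a b c d j → i = j := by
    intro a b c d h1 h2 h3 h4 h5 h6 i hi j hj hij
    interval_cases i <;> interval_cases j <;> simp_all [four]
  by_cases hD : ∃ a b c d, G.Adj a b ∧ G.Adj a c ∧ G.Adj b c ∧ G.Adj a d ∧ G.Adj b d ∧ c ≠ d
  · obtain ⟨a, b, c, d, hab, hac, hbc, had, hbd, hcd⟩ := hD
    have hcd' : ¬ G.Adj c d := fun h => hK a b c d hab hac had hbc hbd h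
    obtain ⟨h1, h2⟩ := verts_four hab hac hbc had hcd' 13 3 (Or.inl ⟨hbd, rfl, rfl⟩)
    refine search_sound hG hP hK (fuel := 10) (k := 3) (M := 127) (x := four a b c d)
      (hinj a b c d hab.ne hac.ne had.ne hbc.ne hbd.ne hcd) (by omega) hab hac hbc ?_ ?_
    · intro w _
      have hw : ¬ (G.Adj w a ∧ G.Adj w b ∧ G.Adj w c) := fun h =>
        hK w a b c h.1 h.2.1 h.2.2 hab hac hbc
      rw [code_three, show four a b c d 0 = a from rfl, show four a b c d 1 = b from rfl,
        show four a b c d 2 = c from rfl]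
      split_ifs <;> first | decide | tauto
    · rw [h1, h2]
      exact search_diamond
  · push Not at hD
    obtain ⟨d, had, hdb, hdc⟩ := exists_third hG a b c
    have hbd : ¬ G.Adj b d := fun h => hdc (hD a b c d hab hac hbc had h).symm
    have hcd : ¬ G.Adj c d := fun h => hdb (hD a c b d hac hab hbc.symm had h).symm
    obtain ⟨h1, h2⟩ := verts_four hab hac hbc had hcd 5 1 (Or.inr ⟨hbd, rfl, rfl⟩)
    refine search_sound hG hP hK (fuel := 10) (k := 3) (M := 23) (x := four a b c d)
      (hinj a b c d hab.ne hac.ne had.ne hbc.ne hdb.symm hdc.symm) (by omega) hab hac hbc ?_ ?_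
    · intro w hw
      have hwa : a ≠ w := hw 0 (by omega)
      have hwb : b ≠ w := hw 1 (by omega)
      have hwc : c ≠ w := hw 2 (by omega)
      have h3 : ¬ (G.Adj w a ∧ G.Adj w b) := fun h =>
        hwc (hD a b c w hab hac hbc h.1.symm h.2.symm)
      have h4 : ¬ (G.Adj w a ∧ G.Adj w c) := fun h =>
        hwb (hD a c b w hac hab hbc.symm h.1.symm h.2.symm)
      have h5 : ¬ (G.Adj w b ∧ G.Adj w c) := fun h =>
        hwa (hD b c a w hbc hab.symm hac.symm h.1.symm h.2.symm)
      rw [code_three, show four a b c d 0 = a from rfl, show four a b c d 1 = b from rfl,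
        show four a b c d 2 = c from rfl]
      split_ifs <;> first | decide | tauto
    · rw [h1, h2]
      exact search_pendant

/-! ### The bound -/

/-- A labelling of an induced cycle of length `m` by residues modulo `m` goes once around the
residues, so that it can be normalised to the identity. -/
lemma exists_normalised {V : Type u} {G : SimpleGraph V} {m : ℕ} (hm : Odd m) {c : ZMod m → V}
    (hc : IndCycle G c) {S : Set V} (hS : Set.range c ⊆ S) {f : V → ZMod m} (hf : ColOn G S f) :
    ∃ g : V → ZMod m, (∀ i, g (c i) = i) ∧ ColOn G S g := by
  have : NeZero m := ⟨hm.pos.ne'⟩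
  have hstep : ∀ i : ℕ, G.Adj (c i) (c (i + 1 : ℕ)) := fun i =>
    (hc _ _).mpr (Or.inl (by push_cast; rfl))
  obtain ⟨-, -, h⟩ := closed_walk_labels (fun i : ℕ => f (c i)) hm
    (fun i _ => hf (hS ⟨_, rfl⟩) (hS ⟨_, rfl⟩) (hstep i)) (by simp)
  rcases h rfl with h | h
  · have key : ∀ i : ℕ, i ≤ m → f (c i) = f (c 0) + i := by
      intro i
      induction i with
      | zero => simp
      | succ i ih =>
        intro hi
        rw [h i hi, ih (by omega)]
        push_cast
        ring
    refine ⟨fun v => f v - f (c 0), fun i => ?_, fun x hx y hy hxy => ?_⟩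
    · have := key i.val (ZMod.val_lt i).le
      rw [ZMod.natCast_zmod_val] at this
      simp only [this]
      ring
    · rcases hf hx hy hxy with h1 | h1
      · left
        simp only [h1]
        ring
      · right
        simp only [h1]
        ring
  · have key : ∀ i : ℕ, i ≤ m → f (c i) = f (c 0) - i := by
      intro i
      induction i with
      | zero => simp
      | succ i ih =>
        intro hi
        have h1 := h i hi
        rw [ih (by omega)] at h1
        push_cast at h1 ⊢
        linear_combination -h1
    refine ⟨fun v => f (c 0) - f v, fun i => ?_, fun x hx y hy hxy => ?_⟩
    · have := key i.val (ZMod.val_lt i).le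
      rw [ZMod.natCast_zmod_val] at this
      simp only [this]
      ring
    · rcases hf hx hy hxy with h1 | h1
      · right
        simp only [h1]
        ring
      · left
        simp only [h1]
        ring

lemma card_le_of_shortest_odd_cycle {V : Type u} {G : SimpleGraph V} {m : ℕ}
    (hG : Critical G (m + 2)) (hm : Odd m) (h5 : 5 ≤ m) {c : ZMod m → V} (hc : IndCycle G c) :
    Nat.card V ≤ 3 * m + 34 := by
  classical
  by_contra hcard
  push Not at hcard
  have : NeZero m := ⟨by omega⟩
  refine LargeObstruction.not_exists (G := G) (c := c)
    { odd := hm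
      five := h5
      length_lt := IndPath.length_lt (by omega) hG.free
      cycle := hc
      not_col := hG.not_col
      dominated := hG.exists_adj_not_adj
      connected := hG.exists_adj_compl
      small := fun S hS => ?_ }
  have hne : (S : Set V) ∪ Set.range c ≠ Set.univ := by
    intro h
    have h1 := Set.ncard_union_le (S : Set V) (Set.range c)
    have h2 : (Set.range c).ncard ≤ m := by
      rw [← Set.image_univ]
      refine (Set.ncard_image_le Set.finite_univ).trans ?_
      simp [Set.ncard_univ]
    rw [h, Set.ncard_univ, Set.ncard_coe_finset] at h1
    omega
  obtain ⟨f, hf⟩ := hG.sub_col _ hne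
  obtain ⟨g, hg, hg'⟩ := exists_normalised hm hc Set.subset_union_right hf
  exact ⟨g, hg, hg'⟩

end CycleObstruction

open CycleObstruction in
theorem theorem3 (k : ℕ) (hk : 4 < k) {V : Type u} [Finite V] (G : SimpleGraph V)
    (hG : IsIndMinimal (fun _ G' => IndFree (SimpleGraph.pathGraph k) G' ∧
      ¬ HColorable (SimpleGraph.cycleGraph (k - 2)) G') G) :
    Nat.card V ≤ 3 * k + 28 := by
  have hC := critical_of_isIndMinimal hk hG
  obtain ⟨n, hn, hn3, hmin, c, hc⟩ := exists_shortest_odd_cycle hC.not_colorable_two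
  have : NeZero n := ⟨by omega⟩
  have hnk : n ≤ k := by
    have := IndPath.length_lt (by omega) hC.free (hc.indPath_arc 0 (len := n - 1) (by omega))
    simp at this
    omega
  by_cases hcol : ∃ f : V → ZMod (k - 2), ColOn G (Set.range c) f
  swap
  · have h1 : (Set.range c).ncard ≤ n := by
      rw [← Set.image_univ]
      refine (Set.ncard_image_le Set.finite_univ).trans ?_
      simp [Set.ncard_univ]
    rw [hC.eq_univ hcol, Set.ncard_univ] at h1
    omega
  obtain ⟨f, hf⟩ := hcol
  obtain ⟨hodd, hle, -⟩ := closed_walk_labels (fun i : ℕ => f (c i)) hn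
    (fun i _ => hf ⟨_, rfl⟩ ⟨_, rfl⟩ ((hc _ _).mpr (Or.inl (by push_cast; rfl)))) (by simp)
  obtain ⟨m, rfl⟩ : ∃ m, k = m + 2 := ⟨k - 2, by omega⟩
  rw [Nat.add_sub_cancel] at hodd hle
  have hcases : n = m + 2 ∨ n = m := by
    obtain ⟨r, hr⟩ := hn
    obtain ⟨s, hs⟩ := hodd
    omega
  rcases hcases with rfl | rfl
  · exact (hC.not_shortest_odd_cycle_eq hk hn hmin hc).elim
  rcases Nat.lt_or_ge n 5 with h5 | h5
  · obtain rfl : n = 3 := by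
      obtain ⟨r, hr⟩ := hn
      omega
    have := card_le_of_triangle hC (a := c 0) (b := c 1) (c := c 2) ((hc _ _).mpr (by decide))
      ((hc _ _).mpr (by decide)) ((hc _ _).mpr (by decide))
    omega
  · have := card_le_of_shortest_odd_cycle hC hn h5 hc
    omega
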